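/- **Kolmogorov-type chargeability theorem.** Let $d\ge 1$ be an integer and write $|A|$ for the Lebesgue measure of $A\subset\mathbb R^d$. *Definitions.* For an integrable $u:\mathbb R^d\to\mathbb R$ let $\|Du\|(\mathbb R^d)=\sup\{\int u\,\mathrm{div}\,\varphi:\varphi\in C^1_c(\mathbb R^d;\mathbb R^d),\ |\varphi|\le 1\}$. Let $BV([0,1]^d)$ be the space of (classes of) integrable functions $u$ on $\mathbb R^d$ that vanish a.e. outside $[0,1]^d$ and satisfy $\|Du\|(\mathbb R^d)<\infty$, with norm $\|u\|_{BV}=\|u\|_{1}+\|Du\|(\mathbb R^d)$. For $f\in L^d([0,1]^d)$ let $T_f\in BV([0,1]^d)^*$ be $T_f(u)=\int_{[0,1]^d}fu$, and let $SCH([0,1]^d)$ be the norm closure of $\{T_f: f\in L^d([0,1]^d)\}$ in $BV([0,1]^d)^*$. A $BV$-subset of $[0,1]^d$ is a measurable $B\subset[0,1]^d$ with $\|B\|:=\|D\mathbf 1_B\|(\mathbb R^d)<\infty$. A charge is a real function $\mu$ of the $BV$-subsets of $[0,1]^d$ such that $\mu(B_1\cup B_2)=\mu(B_1)+\mu(B_2)$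 whenever $|B_1\cap B_2|=0$, and $\mu(B_n)\to\mu(B)$ whenever $\sup_n\|B_n\|<\infty$ and $|B_n\,\triangle\, B|\to0$. A charge $\mu$ is strong if there is $\alpha\in SCH([0,1]^d)$ with $\mu(B)=\alpha(\mathbf 1_B)$ for all $BV$-subsets $B$ of $[0,1]^d$. For a continuous $f:[0,1]^d\to\mathbb R$ and a rectangle $K=\prod_i[a_i,b_i]\subset[0,1]^d$ with $a_i<b_i$, let $$\Delta_fK=\sum_{c\in\prod_i\{a_i,b_i\}}(-1)^{\#\{i\,:\,c_i=a_i\}}f(c);$$ $\Delta_f$ is extended by $\Delta_f(K_1\cup\dots\cup K_p)=\sum_j\Delta_fK_j$ to finite unions of pairwise almost disjoint rectangles. A dyadic cube is a set $\prod_{i=1}^d[2^{-n}k_i,2^{-n}(k_i+1)]$ with integers $n\ge0$ and $0\le k_i\le 2^n-1$. For $\frac{d-1}d<\gamma<1$, the function $f$ is called $\gamma$-Hölder strongly chargeable if $\Delta_f$ extends to a strong charge $\mu$ for which there is $C'\ge0$ with $|\mu(K)|\le C'|K|^\gamma$ for all dyadic cubes $K$. *Theorem.* Let $X=(X_t)_{t\in[0,1]^d}$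 be a real-valued random process on a probability space with continuous sample paths. Let $q>0$, $C\ge0$, $\delta>0$ satisfy $$\frac{d-1}{d}<\frac{\delta}{q}\le 1\qquad\text{and}\qquad \mathbb E\big(|\Delta_XK|^q\big)\le C|K|^{1+\delta}\ \text{ for all dyadic cubes }K.$$ Then almost surely, for every $\gamma$ with $\frac{d-1}{d}<\gamma<\frac{\delta}{q}$, the sample path of $X$ is $\gamma$-Hölder strongly chargeable. -/

import Mathlib

open MeasureTheory Filter Topology
open scoped ENNReal symmDiff

noncomputable section

namespace StrongCharge

/-! ### Variation, functions of bounded variation -/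

/-- The Euclidean space `ℝ^d`, with Euclidean norm and Lebesgue measure. -/
abbrev Space (d : ℕ) : Type := EuclideanSpace ℝ (Fin d)

/-- The closed unit cube `[0,1]^d`, as a subset of `ℝ^d`. -/
def cube (d : ℕ) : Set (Space d) := {x | ∀ i, 0 ≤ x i ∧ x i ≤ 1}

/-- The divergence of a vector field on `ℝ^d`. -/
def divergence {d : ℕ} (φ : Space d → Space d) (x : Space d) : ℝ :=
  ∑ i, (fderiv ℝ φ x (EuclideanSpace.single i 1)) i

/-- Admissible fields in the definition of the variation: `C¹`, compactly supported, with
Euclidean norm at most `1` everywhere. -/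
structure IsTestField {d : ℕ} (φ : Space d → Space d) : Prop where
  contDiff : ContDiff ℝ 1 φ
  hasCompactSupport : HasCompactSupport φ
  norm_le_one : ∀ x, ‖φ x‖ ≤ 1

/-- The variation `‖Du‖(ℝ^d)` of an integrable function `u` on `ℝ^d`. -/
def variation {d : ℕ} (u : Space d → ℝ) : ℝ≥0∞ :=
  ⨆ (φ : Space d → Space d) (_ : IsTestField φ), ENNReal.ofReal (∫ x, u x * divergence φ x)

section VariationLemmas

variable {d : ℕ}

lemma IsTestField.neg {φ : Space d → Space d} (h : IsTestField φ) :
    IsTestField (fun x => - φ x) :=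
  ⟨h.contDiff.neg, h.hasCompactSupport.comp_left (g := fun y => - y) neg_zero,
    fun x => by simpa using h.norm_le_one x⟩

lemma divergence_neg (φ : Space d → Space d) (x : Space d) :
    divergence (fun y => - φ y) x = - divergence φ x := by
  simp [divergence, fderiv_fun_neg]

lemma IsTestField.continuous_divergence {φ : Space d → Space d} (h : IsTestField φ) :
    Continuous (divergence φ) := by
  have h1 : Continuous (fderiv ℝ φ) := h.contDiff.continuous_fderiv one_ne_zero
  refine continuous_finsetSum _ fun i _ => ?_
  exact (EuclideanSpace.proj i : Space d →L[ℝ] ℝ).continuous.comp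
    (h1.clm_apply continuous_const)

lemma IsTestField.hasCompactSupport_divergence {φ : Space d → Space d} (h : IsTestField φ) :
    HasCompactSupport (divergence φ) := by
  have h1 : HasCompactSupport (fderiv ℝ φ) := h.hasCompactSupport.fderiv ℝ
  exact h1.comp_left
    (g := fun L : Space d →L[ℝ] Space d => ∑ i, (L (EuclideanSpace.single i 1)) i) (by simp)

lemma IsTestField.integrable_mul {φ : Space d → Space d} (h : IsTestField φ) {u : Space d → ℝ}
    (hu : Integrable u) : Integrable (fun x => u x * divergence φ x) := by
  obtain ⟨C, hC⟩ := h.hasCompactSupport_divergence.exists_bound_of_continuous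
    h.continuous_divergence
  exact hu.mul_bdd h.continuous_divergence.aestronglyMeasurable (Eventually.of_forall hC)

lemma IsTestField.abs_integral_le {φ : Space d → Space d} (h : IsTestField φ)
    (u : Space d → ℝ) :
    ENNReal.ofReal |∫ x, u x * divergence φ x| ≤ variation u := by
  rcases le_total 0 (∫ x, u x * divergence φ x) with h0 | h0
  · rw [abs_of_nonneg h0]
    exact le_iSup₂_of_le φ h le_rfl
  · rw [abs_of_nonpos h0]
    refine le_iSup₂_of_le _ h.neg ?_
    simp [divergence_neg, integral_neg]

lemma variation_congr {u v : Space d → ℝ} (h : u =ᵐ[volume] v) : variation u = variation v := by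
  refine iSup_congr fun φ => iSup_congr fun _ => congrArg ENNReal.ofReal (integral_congr_ae ?_)
  filter_upwards [h] with x hx
  rw [hx]

lemma variation_zero : variation (fun _ : Space d => (0 : ℝ)) = 0 := by
  simp [variation]

lemma variation_add_le {u v : Space d → ℝ} (hu : Integrable u) (hv : Integrable v) :
    variation (fun x => u x + v x) ≤ variation u + variation v := by
  refine iSup₂_le fun φ hφ => ?_
  simp only [add_mul]
  rw [integral_add (hφ.integrable_mul hu) (hφ.integrable_mul hv)]
  refine ENNReal.ofReal_add_le.trans (add_le_add ?_ ?_)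
  · exact le_iSup₂_of_le φ hφ le_rfl
  · exact le_iSup₂_of_le φ hφ le_rfl

lemma variation_sum_le {ι : Type*} (s : Finset ι) {u : ι → Space d → ℝ}
    (hu : ∀ i, Integrable (u i)) :
    variation (fun x => ∑ i ∈ s, u i x) ≤ ∑ i ∈ s, variation (u i) := by
  classical
  induction s using Finset.induction_on with
  | empty => simp [variation_zero]
  | insert a s ha ih =>
    simp only [Finset.sum_insert ha]
    exact (variation_add_le (hu a) (integrable_finsetSum s fun i _ => hu i)).trans
      (add_le_add le_rfl ih)

lemma variation_smul_le (c : ℝ) (u : Space d → ℝ) :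
    variation (fun x => c * u x) ≤ ENNReal.ofReal |c| * variation u := by
  refine iSup₂_le fun φ hφ => ?_
  simp only [mul_assoc, integral_const_mul]
  calc ENNReal.ofReal (c * ∫ x, u x * divergence φ x)
      ≤ ENNReal.ofReal (|c| * |∫ x, u x * divergence φ x|) := by
        rw [← abs_mul]
        exact ENNReal.ofReal_le_ofReal (le_abs_self _)
    _ = ENNReal.ofReal |c| * ENNReal.ofReal |∫ x, u x * divergence φ x| :=
        ENNReal.ofReal_mul (abs_nonneg c)
    _ ≤ _ := by gcongr; exact hφ.abs_integral_le u

end VariationLemmas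

/-- The functions of `BV(ℝ^d)` that vanish almost everywhere outside `[0,1]^d`, as a subspace
of `L¹(ℝ^d)`. -/
def bvSubmodule (d : ℕ) : Submodule ℝ (Lp ℝ 1 (volume : Measure (Space d))) where
  carrier := {u | (∀ᵐ x, x ∉ cube d → u x = 0) ∧ variation u < ∞}
  zero_mem' := by
    have h : (⇑(0 : Lp ℝ 1 (volume : Measure (Space d)))) =ᵐ[volume] fun _ => (0 : ℝ) :=
      Lp.coeFn_zero _ _ _
    refine ⟨?_, ?_⟩
    · filter_upwards [h] with x hx _ using hx
    · rw [variation_congr h, variation_zero]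
      exact ENNReal.zero_lt_top
  add_mem' := by
    rintro u v ⟨hu, hu'⟩ ⟨hv, hv'⟩
    refine ⟨?_, ?_⟩
    · filter_upwards [hu, hv, Lp.coeFn_add u v] with x h1 h2 h3 hx
      have h4 : (u + v) x = u x + v x := h3
      rw [h4, h1 hx, h2 hx, add_zero]
    · have h : (⇑(u + v)) =ᵐ[volume] fun x => u x + v x := Lp.coeFn_add u v
      rw [variation_congr h]
      exact (variation_add_le (L1.integrable_coeFn u) (L1.integrable_coeFn v)).trans_lt
        (ENNReal.add_lt_top.2 ⟨hu', hv'⟩)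
  smul_mem' := by
    rintro c u ⟨hu, hu'⟩
    refine ⟨?_, ?_⟩
    · filter_upwards [hu, Lp.coeFn_smul c u] with x h1 h3 hx
      simp [h3, h1 hx]
    · have h : (⇑(c • u)) =ᵐ[volume] fun x => c * u x := Lp.coeFn_smul c u
      rw [variation_congr h]
      exact (variation_smul_le c u).trans_lt (ENNReal.mul_lt_top ENNReal.ofReal_lt_top hu')

/-- The space `BV([0,1]^d)`. It carries the norm `‖u‖_{BV} = ‖u‖₁ + ‖Du‖(ℝ^d)` defined below,
not the norm of `L¹`. -/
def BV (d : ℕ) : Type := bvSubmodule d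

instance (d : ℕ) : AddCommGroup (BV d) := inferInstanceAs (AddCommGroup (bvSubmodule d))

instance (d : ℕ) : Module ℝ (BV d) := inferInstanceAs (Module ℝ (bvSubmodule d))

/-- The underlying class in `L¹(ℝ^d)` of an element of `BV([0,1]^d)`. -/
def BV.toL1 {d : ℕ} : BV d →ₗ[ℝ] Lp ℝ 1 (volume : Measure (Space d)) := (bvSubmodule d).subtype

instance (d : ℕ) : Norm (BV d) := ⟨fun u => ‖u.toL1‖ + (variation u.toL1).toReal⟩

lemma BV.norm_def {d : ℕ} (u : BV d) : ‖u‖ = ‖u.toL1‖ + (variation u.toL1).toReal := rfl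

lemma BV.variation_ne_top {d : ℕ} (u : BV d) : variation u.toL1 ≠ ∞ := u.2.2.ne

lemma BV.toL1_injective {d : ℕ} : Function.Injective (BV.toL1 (d := d)) :=
  Subtype.val_injective

lemma BV.norm_smul_le {d : ℕ} (c : ℝ) (u : BV d) : ‖c • u‖ ≤ ‖c‖ * ‖u‖ := by
  rw [BV.norm_def, BV.norm_def, map_smul, norm_smul, mul_add]
  gcongr
  have h : (⇑(c • u.toL1)) =ᵐ[volume] fun x => c * u.toL1 x := Lp.coeFn_smul c u.toL1
  rw [variation_congr h]
  have h2 := ENNReal.toReal_mono (ENNReal.mul_ne_top ENNReal.ofReal_ne_top u.variation_ne_top)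
    (variation_smul_le c u.toL1)
  rwa [ENNReal.toReal_mul, ENNReal.toReal_ofReal (abs_nonneg c)] at h2

instance (d : ℕ) : NormedAddCommGroup (BV d) :=
  AddGroupNorm.toNormedAddCommGroup
    { toFun := fun u => ‖u‖
      map_zero' := by
        have h : (⇑(0 : Lp ℝ 1 (volume : Measure (Space d)))) =ᵐ[volume] fun _ => (0 : ℝ) :=
          Lp.coeFn_zero _ _ _
        rw [BV.norm_def, map_zero, variation_congr h, variation_zero]
        simp
      add_le' := by
        intro u v
        rw [BV.norm_def, BV.norm_def, BV.norm_def, map_add]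
        have h : (⇑(u.toL1 + v.toL1)) =ᵐ[volume] fun x => u.toL1 x + v.toL1 x :=
          Lp.coeFn_add _ _
        have h2 := ENNReal.toReal_mono
          (ENNReal.add_ne_top.2 ⟨u.variation_ne_top, v.variation_ne_top⟩)
          (variation_add_le (L1.integrable_coeFn u.toL1) (L1.integrable_coeFn v.toL1))
        rw [ENNReal.toReal_add u.variation_ne_top v.variation_ne_top] at h2
        rw [variation_congr h]
        have h3 := norm_add_le u.toL1 v.toL1
        linarith
      neg' := by
        have key : ∀ u : BV d, ‖-u‖ ≤ ‖u‖ := fun u => by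
          simpa using BV.norm_smul_le (-1) u
        intro u
        exact le_antisymm (key u) (by simpa using key (-u))
      eq_zero_of_map_eq_zero' := by
        intro u hu
        have hu' : ‖u.toL1‖ + (variation u.toL1).toReal = 0 := hu
        have h1 : ‖u.toL1‖ = 0 := by
          have := norm_nonneg u.toL1
          have := ENNReal.toReal_nonneg (a := variation u.toL1)
          linarith
        apply BV.toL1_injective
        rw [map_zero]
        exact norm_eq_zero.1 h1 }

instance (d : ℕ) : NormedSpace ℝ (BV d) := ⟨BV.norm_smul_le⟩

/-! ### Strong charge functionals -/

/-- The range of `T : L^d([0,1]^d) → BV([0,1]^d)^*`, `T_f(u) = ∫_{[0,1]^d} f u`. -/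
def rangeT (d : ℕ) : Set (StrongDual ℝ (BV d)) :=
  {α | ∃ f : Space d → ℝ, MemLp f d (volume.restrict (cube d)) ∧
    ∀ u : BV d, IntegrableOn (fun x => f x * u.toL1 x) (cube d) ∧
      α u = ∫ x in cube d, f x * u.toL1 x}

/-- The space `SCH([0,1]^d)` of strong charge functionals: the norm closure of the range of `T`
in the dual of `BV([0,1]^d)`. -/
def SCH (d : ℕ) : Set (StrongDual ℝ (BV d)) := closure (rangeT d)

/-! ### `BV`-sets and charges -/

/-- The perimeter `‖A‖ = ‖D 1_A‖(ℝ^d)`. -/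
def perimeter {d : ℕ} (A : Set (Space d)) : ℝ≥0∞ := variation (A.indicator fun _ => (1 : ℝ))

/-- The `BV`-subsets of `[0,1]^d`: Lebesgue measurable subsets with finite perimeter. -/
structure BVSet (d : ℕ) where
  carrier : Set (Space d)
  subset_cube : carrier ⊆ cube d
  nullMeasurableSet : NullMeasurableSet carrier
  perimeter_lt_top : perimeter carrier < ∞

lemma cube_eq_preimage (d : ℕ) :
    cube d = (WithLp.ofLp : Space d → (Fin d → ℝ)) ⁻¹' Set.Icc 0 1 := by
  ext x
  simp [cube, Pi.le_def, forall_and]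

lemma volume_cube_lt_top (d : ℕ) : volume (cube d) < ∞ := by
  rw [cube_eq_preimage, (PiLp.volume_preserving_ofLp (Fin d)).measure_preimage
    measurableSet_Icc.nullMeasurableSet]
  exact isCompact_Icc.measure_lt_top

lemma integrable_indicator {d : ℕ} {A : Set (Space d)} (hA : A ⊆ cube d)
    (hm : NullMeasurableSet A) : Integrable (A.indicator fun _ => (1 : ℝ)) := by
  have hc : MeasurableSet (cube d) := by
    rw [cube_eq_preimage]
    exact (PiLp.volume_preserving_ofLp (Fin d)).measurable measurableSet_Icc
  have h : Integrable ((cube d).indicator fun _ => (1 : ℝ)) :=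
    (integrable_indicator_iff hc).2 (integrableOn_const (volume_cube_lt_top d).ne)
  refine h.mono (aestronglyMeasurable_const.indicator₀ hm) (Eventually.of_forall fun x => ?_)
  by_cases hx : x ∈ A
  · simp [hx, hA hx]
  · simp [hx]

/-- The indicator function of a `BV`-set, as an element of `BV([0,1]^d)`. -/
def BVSet.ind {d : ℕ} (B : BVSet d) : BV d :=
  ⟨(memLp_one_iff_integrable.2
      (integrable_indicator B.subset_cube B.nullMeasurableSet)).toLp _, by
    have h := (memLp_one_iff_integrable.2
      (integrable_indicator B.subset_cube B.nullMeasurableSet)).coeFn_toLp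
    refine ⟨?_, ?_⟩
    · filter_upwards [h] with x hx hx'
      rw [hx, Set.indicator_of_notMem fun hB => hx' (B.subset_cube hB)]
    · rw [variation_congr h]
      exact B.perimeter_lt_top⟩

/-- Charges on `[0,1]^d`: finitely additive functions of `BV`-sets that are continuous with respect
to `BV`-convergence. -/
structure IsCharge {d : ℕ} (μ : BVSet d → ℝ) : Prop where
  additive : ∀ B₁ B₂ B : BVSet d, volume (B₁.carrier ∩ B₂.carrier) = 0 →
    B.carrier = B₁.carrier ∪ B₂.carrier → μ B = μ B₁ + μ B₂
  continuous : ∀ (B : ℕ → BVSet d) (B' : BVSet d), (⨆ n, perimeter (B n).carrier) < ∞ →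
    Tendsto (fun n => volume ((B n).carrier ∆ B'.carrier)) atTop (𝓝 0) →
    Tendsto (fun n => μ (B n)) atTop (𝓝 (μ B'))

/-- Strong charges: the charges of the form `B ↦ α(1_B)` with `α` a strong charge functional. -/
def IsStrongCharge {d : ℕ} (μ : BVSet d → ℝ) : Prop :=
  IsCharge μ ∧ ∃ α ∈ SCH d, ∀ B : BVSet d, μ B = α B.ind

/-! ### Rectangles, figures, dyadic cubes and increments -/

/-- Rectangles `∏ [lo i, hi i]` with nonempty interior contained in `[0,1]^d`. -/
structure Rect (d : ℕ) where
  lo : Fin d → unitInterval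
  hi : Fin d → unitInterval
  lo_lt_hi : ∀ i, lo i < hi i

/-- The subset of `ℝ^d` underlying a rectangle. -/
def Rect.toSet {d : ℕ} (K : Rect d) : Set (Space d) :=
  {x | ∀ i, (K.lo i : ℝ) ≤ x i ∧ x i ≤ (K.hi i : ℝ)}

lemma Rect.toSet_eq_preimage {d : ℕ} (K : Rect d) :
    K.toSet = (WithLp.ofLp : Space d → (Fin d → ℝ)) ⁻¹'
      Set.Icc (fun i => (K.lo i : ℝ)) (fun i => (K.hi i : ℝ)) := by
  ext x
  simp [Rect.toSet, Pi.le_def, forall_and]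

lemma Rect.subset_cube {d : ℕ} (K : Rect d) : K.toSet ⊆ cube d :=
  fun _ hx i => ⟨(K.lo i).2.1.trans (hx i).1, (hx i).2.trans (K.hi i).2.2⟩

lemma Rect.measurableSet {d : ℕ} (K : Rect d) : MeasurableSet K.toSet := by
  rw [K.toSet_eq_preimage]
  exact (PiLp.volume_preserving_ofLp (Fin d)).measurable measurableSet_Icc

lemma Rect.perimeter_lt_top {d : ℕ} (K : Rect d) : perimeter K.toSet < ∞ := by
  rcases d with _ | n
  · have h : perimeter K.toSet = 0 := by simp [perimeter, variation, divergence]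
    rw [h]
    exact ENNReal.zero_lt_top
  set a : Fin (n + 1) → ℝ := fun i => (K.lo i : ℝ) with ha
  set b : Fin (n + 1) → ℝ := fun i => (K.hi i : ℝ) with hb
  have hab : a ≤ b := fun i => (K.lo_lt_hi i).le
  refine lt_of_le_of_lt (b := ENNReal.ofReal (∑ i : Fin (n + 1),
    (1 * volume.real (Set.Icc (a ∘ i.succAbove) (b ∘ i.succAbove)) +
      1 * volume.real (Set.Icc (a ∘ i.succAbove) (b ∘ i.succAbove))))) ?_ ENNReal.ofReal_lt_top
  refine iSup₂_le fun φ hφ => ENNReal.ofReal_le_ofReal ?_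
  have h1 : ∫ x, K.toSet.indicator (fun _ => (1 : ℝ)) x * divergence φ x =
      ∫ y in Set.Icc a b, divergence φ (WithLp.toLp 2 y) := by
    have h2 : (fun x => K.toSet.indicator (fun _ => (1 : ℝ)) x * divergence φ x) =
        K.toSet.indicator (divergence φ) := by
      ext x
      by_cases hx : x ∈ K.toSet <;> simp [hx]
    rw [h2, integral_indicator K.measurableSet, K.toSet_eq_preimage]
    exact (PiLp.volume_preserving_ofLp (Fin (n + 1))).setIntegral_preimage_emb
      (MeasurableEquiv.toLp 2 (Fin (n + 1) → ℝ)).symm.measurableEmbedding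
      (fun y => divergence φ (WithLp.toLp 2 y)) (Set.Icc a b)
  rw [h1]
  let e : (Fin (n + 1) → ℝ) →L[ℝ] Space (n + 1) :=
    ((EuclideanSpace.equiv (Fin (n + 1)) ℝ).symm : (Fin (n + 1) → ℝ) →L[ℝ] Space (n + 1))
  have he : ∀ y, e y = WithLp.toLp 2 y := fun _ => rfl
  have hφc : Continuous φ := hφ.contDiff.continuous
  have hdiv := integral_divergence_of_hasFDerivAt_off_countable' a b hab
    (fun i y => φ (e y) i)
    (fun i y => ((EuclideanSpace.proj i : Space (n + 1) →L[ℝ] ℝ).comp (fderiv ℝ φ (e y))).comp e)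
    ∅ Set.countable_empty (fun i => by fun_prop)
    (fun y _ i => by
      have h3 : HasFDerivAt φ (fderiv ℝ φ (e y)) (e y) :=
        (hφ.contDiff.differentiable one_ne_zero (e y)).hasFDerivAt
      exact ((EuclideanSpace.proj i : Space (n + 1) →L[ℝ] ℝ).hasFDerivAt.comp y
        (h3.comp y e.hasFDerivAt)))
    (by
      have h4 : Continuous (fun y => divergence φ (e y)) :=
        hφ.continuous_divergence.comp e.continuous
      exact h4.continuousOn.integrableOn_compact isCompact_Icc)
  have h5 : ∫ y in Set.Icc a b, divergence φ (WithLp.toLp 2 y) = _ := hdiv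
  rw [h5]
  have hbound : ∀ (i : Fin (n + 1)) (y : Fin (n + 1) → ℝ), ‖φ (e y) i‖ ≤ 1 := fun i y =>
    (PiLp.norm_apply_le (φ (e y)) i).trans (hφ.norm_le_one _)
  refine Finset.sum_le_sum fun i _ => ?_
  have hfin : volume (Set.Icc (a ∘ i.succAbove) (b ∘ i.succAbove)) < ∞ :=
    isCompact_Icc.measure_lt_top
  have h6 := norm_setIntegral_le_of_norm_le_const hfin
    (f := fun y => φ (e (i.insertNth (b i) y)) i) (fun y _ => hbound i _)
  have h7 := norm_setIntegral_le_of_norm_le_const hfin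
    (f := fun y => φ (e (i.insertNth (a i) y)) i) (fun y _ => hbound i _)
  rw [Real.norm_eq_abs] at h6 h7
  exact (le_abs_self _).trans ((abs_sub _ _).trans (add_le_add h6 h7))

/-- Finite unions of pairwise almost disjoint rectangles, that is, rectangular figures, are
`BV`-sets. -/
def figure {d n : ℕ} (K : Fin n → Rect d)
    (hK : Pairwise fun i j => volume ((K i).toSet ∩ (K j).toSet) = 0) : BVSet d where
  carrier := ⋃ i, (K i).toSet
  subset_cube := Set.iUnion_subset fun i => (K i).subset_cube
  nullMeasurableSet := (MeasurableSet.iUnion fun i => (K i).measurableSet).nullMeasurableSet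
  perimeter_lt_top := by
    have h0 : ∀ᵐ x : Space d, ∀ i j, i ≠ j → x ∉ (K i).toSet ∩ (K j).toSet := by
      simp only [ae_all_iff]
      exact fun i j hij => measure_eq_zero_iff_ae_notMem.1 (hK hij)
    have h1 : ((⋃ i, (K i).toSet).indicator fun _ => (1 : ℝ)) =ᵐ[volume]
        fun x => ∑ i, (K i).toSet.indicator (fun _ => (1 : ℝ)) x := by
      filter_upwards [h0] with x hx
      by_cases hxu : x ∈ ⋃ i, (K i).toSet
      · obtain ⟨i, hi⟩ := Set.mem_iUnion.1 hxu
        rw [Set.indicator_of_mem hxu, Finset.sum_eq_single i, Set.indicator_of_mem hi]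
        · intro j _ hji
          exact Set.indicator_of_notMem (fun hj => hx j i hji ⟨hj, hi⟩) _
        · simp
      · rw [Set.indicator_of_notMem hxu]
        refine (Finset.sum_eq_zero fun i _ => ?_).symm
        exact Set.indicator_of_notMem (fun hi => hxu (Set.mem_iUnion.2 ⟨i, hi⟩)) _
    unfold perimeter
    rw [variation_congr h1]
    refine (variation_sum_le _ fun i =>
      integrable_indicator (K i).subset_cube (K i).measurableSet.nullMeasurableSet).trans_lt ?_
    exact ENNReal.sum_lt_top.2 fun i _ => (K i).perimeter_lt_top

/-- A rectangle as a `BV`-set. -/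
def Rect.toBVSet {d : ℕ} (K : Rect d) : BVSet d :=
  ⟨K.toSet, K.subset_cube, K.measurableSet.nullMeasurableSet, K.perimeter_lt_top⟩

/-- The Lebesgue measure `|K|` of a rectangle. -/
def Rect.vol {d : ℕ} (K : Rect d) : ℝ := (volume : Measure (Space d)).real K.toSet

/-- The increment `Δ_f K`: the sum over the vertices `c` of `K` of `f(c)`, with one factor `-1` for
each coordinate of `c` that is a lower endpoint (the set `s` collects these coordinates). -/
def increment {d : ℕ} (f : (Fin d → unitInterval) → ℝ) (K : Rect d) : ℝ :=
  ∑ s : Finset (Fin d), (-1) ^ s.card * f (fun i => if i ∈ s then K.lo i else K.hi i)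

/-- `μ` extends the additive function `Δ_f` of figures. -/
def ExtendsIncrement {d : ℕ} (μ : BVSet d → ℝ) (f : (Fin d → unitInterval) → ℝ) : Prop :=
  ∀ (n : ℕ) (K : Fin n → Rect d)
    (hK : Pairwise fun i j => volume ((K i).toSet ∩ (K j).toSet) = 0),
    μ (figure K hK) = ∑ i, increment f (K i)

lemma dyadic_mem {n k : ℕ} (hk : k ≤ 2 ^ n) : (k : ℝ) / 2 ^ n ∈ unitInterval := by
  refine ⟨by positivity, ?_⟩
  rw [div_le_one (by positivity)]
  exact_mod_cast hk

/-- The dyadic cube `∏ [2^{-n} k_i, 2^{-n} (k_i + 1)]` of generation `n`, where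
`0 ≤ k_i ≤ 2^n - 1`. -/
def dyadicCube {d : ℕ} (n : ℕ) (k : Fin d → Fin (2 ^ n)) : Rect d where
  lo i := ⟨((k i : ℕ) : ℝ) / 2 ^ n, dyadic_mem (k i).2.le⟩
  hi i := ⟨((k i + 1 : ℕ) : ℝ) / 2 ^ n, dyadic_mem (k i).2⟩
  lo_lt_hi i := by
    rw [Subtype.mk_lt_mk]
    gcongr
    exact Nat.lt_succ_self _

/-- A strong charge is `γ`-Hölder if `|μ(K)| ≤ C |K|^γ` for all dyadic cubes `K`. -/
def IsHolder {d : ℕ} (γ : ℝ) (μ : BVSet d → ℝ) : Prop :=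
  ∃ C : ℝ, 0 ≤ C ∧ ∀ (n : ℕ) (k : Fin d → Fin (2 ^ n)),
    |μ (dyadicCube n k).toBVSet| ≤ C * (dyadicCube n k).vol ^ γ

/-- A continuous function `f` on `[0,1]^d` is `γ`-Hölder strongly chargeable if `Δ_f` extends to a
`γ`-Hölder strong charge. -/
def IsHolderStronglyChargeable {d : ℕ} (γ : ℝ) (f : (Fin d → unitInterval) → ℝ) : Prop :=
  ∃ μ : BVSet d → ℝ, IsStrongCharge μ ∧ ExtendsIncrement μ f ∧ IsHolder γ μ

end StrongCharge

end

open StrongCharge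

/-! The proof splits into a deterministic criterion, `isHolderStronglyChargeable_of_increment_le`,
and a probabilistic estimate, `ae_increment_le`.

Criterion. Suppose the increments of `f` over dyadic cubes are bounded by a constant times `|K| ^ γ`
with `γ > (d - 1) / d`. Let `g_n` be the step function equal to increment divided by volume on each
dyadic cell of generation `n`. Additivity of increments makes `g_n` the average of `g_{n+1}` over
blocks of `2 ^ d` cells, so `g_{n+1} - g_n` is a combination of differences `p - p(· - v)` with `p`
bounded by `sup |g_{n+1}|` and `‖v‖ ≤ √d / 2 ^ (n + 1)`. Pairing such a difference with `u` costs at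
most `sup |p| ‖v‖ ‖Du‖` (`abs_integral_mul_sub_translate_le`). Since `sup |g_n|` is of order `2 ^ (n
d (1 - γ))`, the functionals `T_n(u) = ∫ u g_n` satisfy `‖T_{n+1} - T_n‖ ≤ const · 2 ^ (n (d (1 - γ)
- 1))`. The exponent is negative exactly when `γ > (d - 1) / d`, so `T_n` converges in the dual of
`BV` to some `α` in `SCH` (`exists_tendsto_cellDensity`).

The limit restricts to a charge because each `T_n` is continuous for the `L¹` norm and the
convergence is uniform on bounded subsets of `BV` (`isCharge_of_tendsto`). On rectangles with
vertices in the grid of generation `n`, `T_n` gives the increment exactly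
(`integral_ind_mul_cellDensity`); approximating an arbitrary rectangle by such rectangles, and using
the continuity of `f`, identifies `α` with the increment on all rectangles.

Probability. For `γ < δ / q` the sum of `|Δ_X K| ^ q |K| ^ (-γ q)` over all dyadic cubes has finite
expectation, hence is almost surely finite, and it bounds each of its terms. Countably many
exponents tending to `δ / q` give all `γ` on one event of full measure. -/

namespace StrongCharge

/-! ### Pairing a function of bounded variation with a difference of translates. -/

section Translation

variable {d : ℕ}

/-- Average of `k` over the segment from `x - v` to `x`. -/
noncomputable def segmentAverage (k : Space d → ℝ) (v x : Space d) : ℝ := ∫ s in (0 : ℝ)..1, k (x - s • v)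

/-- The average is the convolution of the constant `1` with `k` relative to the image of Lebesgue
measure on `(0, 1]` under `s ↦ s • v`, so it inherits the regularity of `k`. -/
lemma contDiff_segmentAverage {k : Space d → ℝ} (hk : ContDiff ℝ 1 k) (hs : HasCompactSupport k)
    (v : Space d) : ContDiff ℝ 1 (segmentAverage k v) := by
  have hmeas : Measurable fun s : ℝ => s • v := by fun_prop
  let ν : Measure (Space d) := (volume.restrict (Set.Ioc (0 : ℝ) 1)).map fun s => s • v
  have : IsFiniteMeasure ν := by
    have : IsFiniteMeasure (volume.restrict (Set.Ioc (0 : ℝ) 1)) := ⟨by simp⟩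
    exact Measure.isFiniteMeasure_map _ _
  have h := HasCompactSupport.contDiff_convolution_right (μ := ν) (f := fun _ => (1 : ℝ))
    (ContinuousLinearMap.lsmul ℝ ℝ) (n := 1) hs (locallyIntegrable_const _) hk
  refine Eq.subst (motive := ContDiff ℝ 1) (funext fun x => ?_) h
  symm
  rw [segmentAverage, convolution_def, intervalIntegral.integral_of_le zero_le_one]
  have hc : Continuous k := hk.continuous
  rw [integral_map hmeas.aemeasurable]
  · simp
  · exact Continuous.aestronglyMeasurable (by fun_prop)

lemma fderiv_segmentAverage {k : Space d → ℝ} (hk : ContDiff ℝ 1 k) (hs : HasCompactSupport k)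
    (v x : Space d) : fderiv ℝ (segmentAverage k v) x v = k x - k (x - v) := by
  have hc : Continuous k := hk.continuous
  have h1 : HasDerivAt (fun t : ℝ => segmentAverage k v (x + t • v))
      (fderiv ℝ (segmentAverage k v) x v) 0 := by
    have h2 : HasFDerivAt (segmentAverage k v) (fderiv ℝ (segmentAverage k v) x)
        (x + (0 : ℝ) • v) := by
      rw [zero_smul, add_zero]
      exact ((contDiff_segmentAverage hk hs v).differentiable one_ne_zero x).hasFDerivAt
    have h3 : HasDerivAt (fun t : ℝ => x + t • v) v 0 := by
      simpa using ((hasDerivAt_id (0 : ℝ)).smul_const v).const_add x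
    exact h2.comp_hasDerivAt 0 h3
  let g : ℝ → ℝ := fun r => k (x + r • v)
  have hg : Continuous g := by fun_prop
  -- On the line through `x` in direction `v`, the substitution `r = t - s` turns the average into
  -- the integral of `g` over `[t - 1, t]`.
  have h4 : (fun t : ℝ => segmentAverage k v (x + t • v)) =
      fun t => (∫ r in (0 : ℝ)..t, g r) - ∫ r in (0 : ℝ)..(t - 1), g r := by
    ext t
    rw [intervalIntegral.integral_interval_sub_left (hg.intervalIntegrable _ _)
      (hg.intervalIntegrable _ _), segmentAverage]
    have h5 := intervalIntegral.integral_comp_sub_left (a := 0) (b := 1) g t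
    rw [sub_zero] at h5
    rw [← h5]
    refine intervalIntegral.integral_congr fun s _ => ?_
    simp only [g]
    congr 1
    module
  have h6 : HasDerivAt (fun t : ℝ => (∫ r in (0 : ℝ)..t, g r) - ∫ r in (0 : ℝ)..(t - 1), g r)
      (g 0 - g (0 - 1)) 0 := by
    have h7 : ∀ t, HasDerivAt (fun t : ℝ => ∫ r in (0 : ℝ)..t, g r) (g t) t := fun t =>
      intervalIntegral.integral_hasDerivAt_right (hg.intervalIntegrable _ _)
        hg.aestronglyMeasurable.stronglyMeasurableAtFilter hg.continuousAt
    exact (h7 0).sub (by simpa using (h7 (0 - 1)).comp_sub_const 0 1)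
  rw [← h4] at h6
  rw [h1.unique h6]
  simp [g, sub_eq_add_neg]

lemma hasCompactSupport_segmentAverage {k : Space d → ℝ} (hs : HasCompactSupport k)
    (v : Space d) : HasCompactSupport (segmentAverage k v) := by
  obtain ⟨R, hR⟩ := hs.isCompact.isBounded.subset_closedBall 0
  refine HasCompactSupport.intro (isCompact_closedBall (0 : Space d) (R + ‖v‖)) fun x hx => ?_
  rw [segmentAverage]
  refine (intervalIntegral.integral_congr (g := fun _ => (0 : ℝ)) fun s hs => ?_).trans (by simp)
  rw [Set.uIcc_of_le zero_le_one] at hs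
  by_contra hne
  have h1 := hR (subset_tsupport k hne)
  rw [mem_closedBall_zero_iff] at h1 hx
  have h2 : ‖s • v‖ ≤ ‖v‖ := by
    rw [norm_smul, Real.norm_of_nonneg hs.1]
    exact mul_le_of_le_one_left (norm_nonneg v) hs.2
  have h3 := norm_add_le (x - s • v) (s • v)
  rw [sub_add_cancel] at h3
  exact hx (by linarith)

lemma abs_segmentAverage_le {k : Space d → ℝ} {M : ℝ} (hM : ∀ x, |k x| ≤ M) (v x : Space d) :
    |segmentAverage k v x| ≤ M := by
  have h := intervalIntegral.norm_integral_le_of_norm_le_const (a := 0) (b := 1)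
    (f := fun s : ℝ => k (x - s • v)) (C := M) (fun s _ => hM _)
  simpa [segmentAverage] using h

lemma divergence_smul_const {ψ : Space d → ℝ} (hψ : Differentiable ℝ ψ) (v x : Space d) :
    divergence (fun y => ψ y • v) x = fderiv ℝ ψ x v := by
  have h : fderiv ℝ (fun y => ψ y • v) x = (fderiv ℝ ψ x).smulRight v :=
    ((hψ x).hasFDerivAt.smul_const v).fderiv
  conv_rhs => rw [← (EuclideanSpace.basisFun (Fin d) ℝ).sum_repr v]
  simp [divergence, h, mul_comm]

/-- The difference `k - k(· - v)` is the divergence of the field `w v`, where `w` is the average of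
`k` along `v`. Divided by `M ‖v‖`, this field is admissible in the definition of the variation. -/
lemma abs_integral_mul_sub_translate_le_of_contDiff {u : Space d → ℝ} (hV : variation u ≠ ∞)
    {k : Space d → ℝ} (hk : ContDiff ℝ 1 k) (hs : HasCompactSupport k) {M : ℝ}
    (hM : ∀ x, |k x| ≤ M) (v : Space d) :
    |∫ x, u x * (k x - k (x - v))| ≤ M * ‖v‖ * (variation u).toReal := by
  have hM0 : 0 ≤ M := (abs_nonneg _).trans (hM 0)
  -- If `M ‖v‖ = 0` the normalisation is impossible, but then `k = 0` or `v = 0` and the integral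
  -- vanishes.
  rcases eq_or_lt_of_le (mul_nonneg hM0 (norm_nonneg v)) with h0 | hpos
  · rcases mul_eq_zero.1 h0.symm with h | h
    · have : ∀ x, k x = 0 := fun x => abs_nonpos_iff.1 ((hM x).trans h.le)
      simp [this, h]
    · simp [norm_eq_zero.1 h]
  set c := M * ‖v‖ with hc
  have hφ : IsTestField fun y => (c⁻¹ * segmentAverage k v y) • v := by
    refine ⟨?_, ?_, fun x => ?_⟩
    · exact ((contDiff_const.mul (contDiff_segmentAverage hk hs v))).smul contDiff_const
    · exact ((hasCompactSupport_segmentAverage hs v).mul_left (f := fun _ => c⁻¹)).smul_right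
    · rw [norm_smul, norm_mul, Real.norm_of_nonneg (inv_pos.2 hpos).le, mul_assoc,
        inv_mul_le_iff₀ hpos, mul_one]
      exact mul_le_mul_of_nonneg_right (abs_segmentAverage_le hM v x) (norm_nonneg v)
  have hd := (contDiff_segmentAverage hk hs v).differentiable one_ne_zero
  have h1 : ∀ x, divergence (fun y => (c⁻¹ * segmentAverage k v y) • v) x =
      c⁻¹ * (k x - k (x - v)) := fun x => by
    rw [divergence_smul_const (hd.const_mul _), fderiv_const_mul (hd x),
      smul_apply, fderiv_segmentAverage hk hs, smul_eq_mul]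
  have h2 := hφ.abs_integral_le u
  simp only [h1, mul_left_comm _ c⁻¹, integral_const_mul, abs_mul, abs_of_pos (inv_pos.2 hpos)]
    at h2
  have h3 := (ENNReal.ofReal_le_iff_le_toReal hV).1 h2
  rwa [inv_mul_le_iff₀ hpos] at h3

/-- Translating a bounded function by `v` changes its pairing with `u` by at most `‖v‖‖Du‖`. -/
lemma abs_integral_mul_sub_translate_le {u : Space d → ℝ} (hu : Integrable u)
    (hV : variation u ≠ ∞) {k : Space d → ℝ} (hk : Measurable k) (hs : HasCompactSupport k)
    {M : ℝ} (hM : ∀ x, |k x| ≤ M) (v : Space d) :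
    |∫ x, u x * (k x - k (x - v))| ≤ M * ‖v‖ * (variation u).toReal := by
  have hM0 : 0 ≤ M := (abs_nonneg _).trans (hM 0)
  have hki : LocallyIntegrable k (volume : Measure (Space d)) := by
    refine (locallyIntegrable_const M).mono hk.aestronglyMeasurable (Eventually.of_forall ?_)
    intro x
    rw [Real.norm_of_nonneg hM0]
    exact hM x
  -- Mollification reduces to the smooth case. The ratio of outer to inner radius is kept equal to
  -- `2`, as almost everywhere convergence at Lebesgue points requires a bounded ratio.
  let b : ℕ → ContDiffBump (0 : Space d) := fun n =>
    ⟨1 / ((n : ℝ) + 1), 2 * (1 / ((n : ℝ) + 1)), by positivity,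
      by have : 0 < 1 / ((n : ℝ) + 1) := by positivity
         linarith⟩
  have hb : Tendsto (fun n => (b n).rOut) atTop (𝓝 0) := by
    have := (tendsto_one_div_add_atTop_nhds_zero_nat (𝕜 := ℝ)).const_mul 2
    simpa only [mul_zero] using this
  let K : ℕ → Space d → ℝ := fun n =>
    convolution ((b n).normed volume) k (ContinuousLinearMap.lsmul ℝ ℝ) volume
  have hKc : ∀ n, ContDiff ℝ 1 (K n) := fun n =>
    HasCompactSupport.contDiff_convolution_left (n := 1) _ (b n).hasCompactSupport_normed
      (b n).contDiff_normed hki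
  have hKs : ∀ n, HasCompactSupport (K n) := fun n =>
    HasCompactSupport.convolution _ (b n).hasCompactSupport_normed hs
  -- Averaging against a probability density preserves the bound `M`: the values of `k` lie within
  -- distance `M` of `z₀ = 0`.
  have hKM : ∀ n x, |K n x| ≤ M := fun n x => by
    have := dist_convolution_le (μ := (volume : Measure (Space d))) (f := (b n).normed volume)
      (g := k) (x₀ := x) (R := (b n).rOut) (z₀ := (0 : ℝ)) hM0 (b n).support_normed_eq.subset
      (b n).nonneg_normed (b n).integral_normed hk.aestronglyMeasurable
      (fun y _ => by simpa using hM y)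
    simpa using this
  have hlim : ∀ᵐ x : Space d, Tendsto (fun n => K n x) atTop (𝓝 (k x)) :=
    ContDiffBump.ae_convolution_tendsto_right_of_locallyIntegrable (K := 2) hb
      (Eventually.of_forall fun n => le_rfl) hki
  have hlim' : ∀ᵐ x : Space d, Tendsto (fun n => K n (x - v)) atTop (𝓝 (k (x - v))) :=
    (measurePreserving_sub_right (volume : Measure (Space d)) v).quasiMeasurePreserving.ae hlim
  have hconv : Tendsto (fun n => ∫ x, u x * (K n x - K n (x - v))) atTop
      (𝓝 (∫ x, u x * (k x - k (x - v)))) := by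
    refine tendsto_integral_of_dominated_convergence (fun x => ‖u x‖ * (M + M)) (fun n => ?_)
      (hu.norm.mul_const _) (fun n => Eventually.of_forall fun x => ?_) ?_
    · have := (hKc n).continuous
      exact hu.aestronglyMeasurable.mul (Continuous.aestronglyMeasurable (by fun_prop))
    · rw [norm_mul]
      refine mul_le_mul_of_nonneg_left ?_ (norm_nonneg _)
      exact (norm_sub_le _ _).trans (add_le_add (hKM n _) (hKM n _))
    · filter_upwards [hlim, hlim'] with x h1 h2
      exact (h1.sub h2).const_mul _
  exact le_of_tendsto hconv.abs (Eventually.of_forall fun n =>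
    abs_integral_mul_sub_translate_le_of_contDiff hV (hKc n) (hKs n) (hKM n) v)

end Translation

/-! ### Additivity of increments over product grids. -/

section GridIncrement

variable {d : ℕ} {ι : Type*}

/-- The alternating sum of `f` over the vertices of the box with opposite corners `a`, `b`. -/
def boxIncrement (f : (Fin d → ι) → ℝ) (a b : Fin d → ι) : ℝ :=
  ∑ s : Finset (Fin d), (-1) ^ s.card * f (fun i => if i ∈ s then a i else b i)

variable [DecidableEq ι]

/-- The increment pairs `f` with a product of differences of point masses. Expanding the product
over subsets `s` leaves, for each `s`, the one vertex with coordinates `a` on `s` and `b` off it. In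
this form additivity becomes a telescoping in each coordinate separately. -/
lemma boxIncrement_eq_sum (f : (Fin d → ι) → ℝ) {a b : Fin d → ι} {S : Fin d → Finset ι}
    (ha : ∀ i, a i ∈ S i) (hb : ∀ i, b i ∈ S i) :
    boxIncrement f a b = ∑ k ∈ Fintype.piFinset S,
      (∏ i, ((if k i = b i then 1 else 0) - (if k i = a i then 1 else 0))) * f k := by
  simp only [Finset.prod_sub, Finset.powerset_univ, Finset.sum_mul]
  rw [Finset.sum_comm]
  refine Finset.sum_congr rfl fun s _ => ?_
  rw [Finset.sum_eq_single (fun i => if i ∈ s then a i else b i)]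
  · rw [Finset.prod_eq_one, Finset.prod_eq_one] <;> simp +contextual
  · intro k _ hk
    obtain ⟨i, hi⟩ := Function.ne_iff.1 hk
    by_cases his : i ∈ s
    · rw [Finset.prod_eq_zero (s := s) his (by simpa [his] using hi)]
      simp
    · rw [Finset.prod_eq_zero (s := Finset.univ \ s) (i := i) (by simpa using his)
        (by simpa [his] using hi)]
      simp
  · intro h
    refine absurd (Fintype.mem_piFinset.2 fun i => ?_) h
    split_ifs
    exacts [ha i, hb i]

lemma boxIncrement_eq_zero (f : (Fin d → ι) → ℝ) {a b : Fin d → ι} {i : Fin d} (h : a i = b i) :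
    boxIncrement f a b = 0 := by
  rw [boxIncrement_eq_sum f (S := fun i => {a i, b i}) (by simp) (by simp)]
  refine Finset.sum_eq_zero fun k _ => ?_
  rw [Finset.prod_eq_zero (Finset.mem_univ i) (by simp [h]), zero_mul]

/-- Additivity of the increment over a product grid. -/
lemma boxIncrement_grid (f : (Fin d → ι) → ℝ) (x : Fin d → ℕ → ι) (N : Fin d → ℕ) :
    boxIncrement f (fun i => x i 0) (fun i => x i (N i)) =
      ∑ r ∈ Fintype.piFinset fun i => Finset.range (N i),
        boxIncrement f (fun i => x i (r i)) (fun i => x i (r i + 1)) := by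
  -- A common index set for all cells of the grid lets the sums over cells and over vertices be
  -- interchanged.
  let S : Fin d → Finset ι := fun i => (Finset.range (N i + 1)).image (x i)
  have hS : ∀ i j, j ≤ N i → x i j ∈ S i := fun i j hj =>
    Finset.mem_image_of_mem _ (Finset.mem_range.2 (Nat.lt_succ_of_le hj))
  rw [boxIncrement_eq_sum f (S := S) (fun i => hS i 0 (Nat.zero_le _)) (fun i => hS i _ le_rfl)]
  have h1 : ∀ r ∈ Fintype.piFinset fun i => Finset.range (N i),
      boxIncrement f (fun i => x i (r i)) (fun i => x i (r i + 1)) =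
      ∑ k ∈ Fintype.piFinset S,
      (∏ i, ((if k i = x i (r i + 1) then 1 else 0) - (if k i = x i (r i) then 1 else 0))) * f k :=
    fun r hr => by
      have hr' : ∀ i, r i < N i := fun i => by simpa using Fintype.mem_piFinset.1 hr i
      exact boxIncrement_eq_sum f (fun i => hS i _ (hr' i).le) (fun i => hS i _ (hr' i))
  rw [Finset.sum_congr rfl h1, Finset.sum_comm]
  refine Finset.sum_congr rfl fun k _ => ?_
  rw [← Finset.sum_mul]
  congr 1
  rw [← Finset.prod_univ_sum (fun i => Finset.range (N i)) fun i j =>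
    ((if k i = x i (j + 1) then (1 : ℝ) else 0) - (if k i = x i j then 1 else 0))]
  exact Finset.prod_congr rfl fun i _ =>
    (Finset.sum_range_sub (fun j => if k i = x i j then (1 : ℝ) else 0) (N i)).symm

end GridIncrement

/-! ### Dyadic densities and the size of their consecutive differences. -/

section DyadicDensity

variable {d : ℕ}

/-- The point of the unit interval closest to `j / 2 ^ n`. -/
noncomputable def dyadicPoint (n : ℕ) (j : ℤ) : unitInterval :=
  Set.projIcc 0 1 zero_le_one ((j : ℝ) / 2 ^ n)

lemma dyadicPoint_succ_two_mul (n : ℕ) (j : ℤ) :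
    dyadicPoint (n + 1) (2 * j) = dyadicPoint n j := by
  rw [dyadicPoint, dyadicPoint, pow_succ']
  push_cast
  rw [mul_div_mul_left _ _ two_ne_zero]

lemma dyadicPoint_of_neg {n : ℕ} {j : ℤ} (hj : j ≤ 0) : dyadicPoint n j = 0 := by
  refine Set.projIcc_of_le_left _ (div_nonpos_of_nonpos_of_nonneg ?_ (by positivity))
  exact_mod_cast hj

lemma dyadicPoint_of_ge {n : ℕ} {j : ℤ} (hj : 2 ^ n ≤ j) : dyadicPoint n j = 1 := by
  refine Set.projIcc_of_right_le _ ((one_le_div (by positivity)).2 ?_)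
  exact_mod_cast hj

lemma dyadicPoint_natCast {n k : ℕ} (hk : k ≤ 2 ^ n) :
    dyadicPoint n k = ⟨(k : ℝ) / 2 ^ n, dyadic_mem hk⟩ := by
  rw [dyadicPoint, Int.cast_natCast]
  exact Set.projIcc_of_mem _ (dyadic_mem hk)

/-- The increment of `f` over the cell of generation `n` with index `j`; it vanishes for cells
that do not lie in the unit cube. -/
noncomputable def cellIncrement (f : (Fin d → unitInterval) → ℝ) (n : ℕ) (j : Fin d → ℤ) : ℝ :=
  boxIncrement f (fun i => dyadicPoint n (j i)) (fun i => dyadicPoint n (j i + 1))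

/-- Clamping to the unit interval makes the two endpoints in direction `i` coincide. Densities are
thus defined on all of `ℤ^d`, and translation arguments need no separate treatment of the boundary.
-/
lemma cellIncrement_eq_zero (f : (Fin d → unitInterval) → ℝ) {n : ℕ} {j : Fin d → ℤ} {i : Fin d}
    (h : ¬ (0 ≤ j i ∧ j i < 2 ^ n)) : cellIncrement f n j = 0 := by
  refine boxIncrement_eq_zero f (i := i) ?_
  rcases not_and_or.1 h with h | h
  · rw [dyadicPoint_of_neg (by lia), dyadicPoint_of_neg (by lia)]
  · rw [dyadicPoint_of_ge (by lia), dyadicPoint_of_ge (by lia)]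

lemma increment_dyadicCube (f : (Fin d → unitInterval) → ℝ) (n : ℕ) (k : Fin d → Fin (2 ^ n)) :
    increment f (dyadicCube n k) = cellIncrement f n fun i => ((k i : ℕ) : ℤ) := by
  have h1 : (fun i => dyadicPoint n ((k i : ℕ) : ℤ)) = (dyadicCube n k).lo :=
    funext fun i => dyadicPoint_natCast (k i).2.le
  have h2 : (fun i => dyadicPoint n (((k i : ℕ) : ℤ) + 1)) = (dyadicCube n k).hi :=
    funext fun i => dyadicPoint_natCast (k := k i + 1) (k i).2
  rw [cellIncrement, h1, h2]
  rfl

lemma abs_cellIncrement_le {f : (Fin d → unitInterval) → ℝ} {n : ℕ} {c : ℝ} (hc : 0 ≤ c)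
    (h : ∀ k : Fin d → Fin (2 ^ n), |increment f (dyadicCube n k)| ≤ c) (j : Fin d → ℤ) :
    |cellIncrement f n j| ≤ c := by
  by_cases hj : ∀ i, 0 ≤ j i ∧ j i < 2 ^ n
  · have hlt : ∀ i, (j i).toNat < 2 ^ n := fun i => by
      zify
      rw [Int.toNat_of_nonneg (hj i).1]
      exact (hj i).2
    have := h fun i => ⟨(j i).toNat, hlt i⟩
    rw [increment_dyadicCube] at this
    convert this using 3
    ext i
    exact (Int.toNat_of_nonneg (hj i).1).symm
  · push Not at hj
    obtain ⟨i, hi⟩ := hj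
    rw [cellIncrement_eq_zero f (i := i) (by lia), abs_zero]
    exact hc

/-- The vectors with entries `0` and `1`. -/
def bits (d : ℕ) : Finset (Fin d → ℕ) := Fintype.piFinset fun _ => Finset.range 2

lemma mem_bits {r : Fin d → ℕ} : r ∈ bits d ↔ ∀ i, r i < 2 := by simp [bits]

lemma card_bits : (bits d).card = 2 ^ d := by simp [bits]

lemma cellIncrement_succ (f : (Fin d → unitInterval) → ℝ) (n : ℕ) (k : Fin d → ℤ) :
    cellIncrement f n k = ∑ r ∈ bits d, cellIncrement f (n + 1) fun i => 2 * k i + r i := by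
  have h := boxIncrement_grid f (fun i m => dyadicPoint (n + 1) (2 * k i + (m : ℕ))) fun _ => 2
  have h2 : ∀ i, 2 * k i + ((2 : ℕ) : ℤ) = 2 * (k i + 1) := fun i => by push_cast; ring
  simp only [Nat.cast_zero, add_zero, h2, dyadicPoint_succ_two_mul] at h
  rw [cellIncrement, h]
  refine Finset.sum_congr rfl fun r _ => ?_
  simp only [cellIncrement, Nat.cast_add, Nat.cast_one, add_assoc]

/-- The restriction of `G` to the indices whose vector of parities is `r`. -/
noncomputable def parityPart (G : (Fin d → ℤ) → ℝ) (r : Fin d → ℕ) (j : Fin d → ℤ) : ℝ :=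
  open Classical in if ∀ i, j i % 2 = r i then G j else 0

lemma abs_parityPart_le {G : (Fin d → ℤ) → ℝ} {M : ℝ} (hM : ∀ j, |G j| ≤ M) (r : Fin d → ℕ)
    (j : Fin d → ℤ) : |parityPart G r j| ≤ M := by
  rw [parityPart]
  split_ifs
  · exact hM j
  · rw [abs_zero]
    exact (abs_nonneg _).trans (hM j)

/-- The deviation of `G` from its averages over the blocks of side `2`, as a sum of differences of
functions and their translates. -/
lemma sub_sum_block_eq (G : (Fin d → ℤ) → ℝ) (j : Fin d → ℤ) :
    2 ^ d * G j - ∑ r ∈ bits d, G (fun i => 2 * (j i / 2) + r i) =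
      ∑ r ∈ bits d, ∑ r' ∈ bits d,
        (parityPart G r' j - parityPart G r' fun i => j i - (r i - r' i)) := by
  -- Only the parity vector `r₀` of `j` contributes: in the first double sum it forces `r' = r₀`, in
  -- the second it forces `r = r₀`, and the shifted index is then the `r'`-th element of the block
  -- of `j`. Cutting `G` by parity makes the shift `r - r'` independent of `j`.
  set r₀ : Fin d → ℕ := fun i => (j i % 2).toNat with hr₀
  have hr₀' : ∀ i, (r₀ i : ℤ) = j i % 2 := fun i => Int.toNat_of_nonneg (by lia)
  have hmem : r₀ ∈ bits d := mem_bits.2 fun i => by have := hr₀' i; lia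
  simp only [Finset.sum_sub_distrib]
  congr 1
  · rw [Finset.sum_const, card_bits, nsmul_eq_mul, Finset.sum_eq_single r₀]
    · simp [parityPart, hr₀']
    · intro r _ hr
      rw [parityPart, if_neg]
      intro h
      exact hr (funext fun i => by have := h i; have := hr₀' i; lia)
    · exact fun h => absurd hmem h
  · symm
    rw [Finset.sum_eq_single r₀]
    · refine Finset.sum_congr rfl fun r hr => ?_
      have hr := mem_bits.1 hr
      rw [parityPart, if_pos fun i => by have := hr i; have := hr₀' i; lia]
      congr 1
      ext i
      have := hr₀' i
      lia
    · intro r hr hne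
      refine Finset.sum_eq_zero fun r' hr' => ?_
      rw [parityPart, if_neg]
      intro h
      have hr := mem_bits.1 hr
      have hr' := mem_bits.1 hr'
      exact hne (funext fun i => by have := h i; have := hr₀' i; have := hr i; have := hr' i; lia)
    · exact fun h => absurd hmem h

/-- The index of the half-open dyadic cell of generation `n` that contains `x`. -/
noncomputable def cellIndex (n : ℕ) (x : Space d) : Fin d → ℤ := fun i => ⌊2 ^ n * x i⌋

lemma measurable_cellIndex (n : ℕ) : Measurable (cellIndex (d := d) n) := by
  refine measurable_pi_lambda _ fun i => Int.measurable_floor.comp ?_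
  exact (EuclideanSpace.proj i : Space d →L[ℝ] ℝ).continuous.measurable.const_mul _

lemma measurable_comp_cellIndex (G : (Fin d → ℤ) → ℝ) (n : ℕ) :
    Measurable fun x : Space d => G (cellIndex n x) :=
  (Measurable.of_discrete (f := G)).comp (measurable_cellIndex n)

lemma cellIndex_eq_div_two (n : ℕ) (x : Space d) (i : Fin d) :
    cellIndex n x i = cellIndex (n + 1) x i / 2 := by
  simp only [cellIndex, pow_succ', mul_assoc]
  set y := 2 ^ n * x i
  have h1 : 2 * ⌊y⌋ ≤ ⌊2 * y⌋ := by
    rw [Int.le_floor]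
    push_cast
    linarith [Int.floor_le y]
  have h2 : ⌊2 * y⌋ < 2 * ⌊y⌋ + 2 := by
    rw [Int.floor_lt]
    push_cast
    linarith [Int.lt_floor_add_one y]
  lia

/-- Shifts of the index correspond to honest translations of `ℝ^d`, to which the `BV` estimate
applies. -/
lemma cellIndex_sub (n : ℕ) (x : Space d) (m : Fin d → ℤ) :
    cellIndex n (x - WithLp.toLp 2 fun i => (m i : ℝ) / 2 ^ n) =
      fun i => cellIndex n x i - m i := by
  ext i
  simp only [cellIndex, PiLp.sub_apply, mul_sub]
  rw [mul_div_cancel₀ _ (by positivity), Int.floor_sub_intCast]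

lemma mem_cube_of_cellIndex {n : ℕ} {x : Space d}
    (h : ∀ i, 0 ≤ cellIndex n x i ∧ cellIndex n x i < 2 ^ n) : x ∈ cube d := by
  intro i
  have hp : (0 : ℝ) < 2 ^ n := by positivity
  refine ⟨?_, ?_⟩
  · exact nonneg_of_mul_nonneg_right (Int.floor_nonneg.1 (h i).1) hp
  · have h2 := Int.floor_lt.1 (h i).2
    push_cast at h2
    nlinarith

/-- The density of generation `n`: on each dyadic cell, the increment divided by the volume. -/
noncomputable def cellDensity (f : (Fin d → unitInterval) → ℝ) (n : ℕ) (j : Fin d → ℤ) : ℝ :=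
  (2 ^ d) ^ n * cellIncrement f n j

lemma cellDensity_eq_average (f : (Fin d → unitInterval) → ℝ) (n : ℕ) (x : Space d) :
    cellDensity f n (cellIndex n x) = (2 ^ d)⁻¹ *
      ∑ r ∈ bits d, cellDensity f (n + 1) fun i => 2 * (cellIndex (n + 1) x i / 2) + r i := by
  simp only [cellDensity, cellIncrement_succ f n, cellIndex_eq_div_two n x, pow_succ,
    ← Finset.mul_sum]
  rw [← mul_assoc]
  congr 1
  field_simp

lemma isCompact_cube : IsCompact (cube d) := by
  rw [cube_eq_preimage]
  exact (EuclideanSpace.equiv (Fin d) ℝ).toHomeomorph.isClosedEmbedding.isCompact_preimage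
    isCompact_Icc

lemma hasCompactSupport_parityPart (f : (Fin d → unitInterval) → ℝ) (n : ℕ) (r : Fin d → ℕ) :
    HasCompactSupport fun x : Space d => parityPart (cellDensity f n) r (cellIndex n x) := by
  refine HasCompactSupport.intro isCompact_cube fun x hx => ?_
  have h : ¬ ∀ i, 0 ≤ cellIndex n x i ∧ cellIndex n x i < 2 ^ n := mt mem_cube_of_cellIndex hx
  obtain ⟨i, hi⟩ := not_forall.1 h
  simp [parityPart, cellDensity, cellIncrement_eq_zero f hi]

/-- The cancellation estimate: a gain of `2 ^ (-(n + 1))` from the length of the translations,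
against the growth of the sup bound `M`. There are `4 ^ d` pairs `(r, r')`, and the averaging factor
`2 ^ (-d)` leaves `2 ^ d`. -/
lemma abs_integral_mul_cellDensity_sub_le (f : (Fin d → unitInterval) → ℝ) (n : ℕ) {M : ℝ}
    (hM : ∀ j, |cellDensity f (n + 1) j| ≤ M) {u : Space d → ℝ} (hu : Integrable u)
    (hV : variation u ≠ ∞) :
    |∫ x, u x * (cellDensity f (n + 1) (cellIndex (n + 1) x) - cellDensity f n (cellIndex n x))| ≤
      2 ^ d * (M * (√d / 2 ^ (n + 1)) * (variation u).toReal) := by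
  set N := n + 1 with hN
  let p : (Fin d → ℕ) → Space d → ℝ := fun r x => parityPart (cellDensity f N) r (cellIndex N x)
  let v : (Fin d → ℕ) → (Fin d → ℕ) → Space d := fun r r' =>
    WithLp.toLp 2 fun i => (((r i : ℤ) - (r' i : ℤ) : ℤ) : ℝ) / 2 ^ N
  have hM0 : 0 ≤ M := (abs_nonneg _).trans (hM 0)
  have hp : ∀ r, Measurable (p r) := fun r => measurable_comp_cellIndex _ N
  have hpM : ∀ r x, |p r x| ≤ M := fun r x => abs_parityPart_le hM r _
  have hi : ∀ r r', Integrable fun x => u x * (p r' x - p r' (x - v r r')) := fun r r' => by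
    refine hu.mul_bdd (c := M + M) ?_ (Eventually.of_forall fun x => ?_)
    · exact ((hp r').sub ((hp r').comp (measurable_sub_const _))).aestronglyMeasurable
    · exact (norm_sub_le _ _).trans (add_le_add (hpM r' _) (hpM r' _))
  -- Each coordinate of the translation is `0` or `± 2 ^ (-N)`.
  have hv : ∀ r ∈ bits d, ∀ r' ∈ bits d, ‖v r r'‖ ≤ √d / 2 ^ N := fun r hr r' hr' => by
    rw [EuclideanSpace.norm_eq, Real.sqrt_le_left (by positivity), div_pow,
      Real.sq_sqrt (by positivity)]
    calc ∑ i, ‖v r r' i‖ ^ 2 ≤ ∑ _i : Fin d, 1 / (2 ^ N) ^ 2 := by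
          refine Finset.sum_le_sum fun i _ => ?_
          have h1 : ‖v r r' i‖ = |(((r i : ℤ) - (r' i : ℤ) : ℤ) : ℝ)| / 2 ^ N := by
            simp [v]
          have h2 : |(r i : ℤ) - (r' i : ℤ)| ≤ 1 := by
            have := mem_bits.1 hr i
            have := mem_bits.1 hr' i
            rw [abs_le]
            lia
          rw [h1, div_pow]
          gcongr
          rw [sq_le_one_iff_abs_le_one, abs_abs]
          exact_mod_cast h2
      _ = d / (2 ^ N) ^ 2 := by simp [div_eq_mul_inv]
  have hpt : ∀ x, u x * (cellDensity f N (cellIndex N x) - cellDensity f n (cellIndex n x)) =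
      (2 ^ d)⁻¹ * ∑ r ∈ bits d, ∑ r' ∈ bits d, u x * (p r' x - p r' (x - v r r')) := fun x => by
    have h := sub_sum_block_eq (cellDensity f N) (cellIndex N x)
    have h2 : ∀ r r', p r' (x - v r r') = parityPart (cellDensity f N) r'
        fun i => cellIndex N x i - ((r i : ℤ) - r' i) := fun r r' => by
      simp only [p, v]
      rw [cellIndex_sub]
    simp only [← Finset.mul_sum, h2]
    rw [← h, cellDensity_eq_average f n x]
    field_simp
    ring
  simp only [hpt, integral_const_mul]
  rw [integral_finsetSum _ fun r _ => integrable_finsetSum _ fun r' _ => hi r r', abs_mul,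
    abs_of_pos (by positivity), inv_mul_le_iff₀ (by positivity)]
  set B := M * (√d / 2 ^ N) * (variation u).toReal with hB
  have hterm : ∀ r ∈ bits d, |∫ x, ∑ r' ∈ bits d, u x * (p r' x - p r' (x - v r r'))| ≤
      2 ^ d * B := fun r hr => by
    rw [integral_finsetSum _ fun r' _ => hi r r']
    refine (Finset.abs_sum_le_sum_abs _ _).trans ((Finset.sum_le_card_nsmul _ _ B ?_).trans ?_)
    · intro r' hr'
      refine (abs_integral_mul_sub_translate_le hu hV (hp r')
        (hasCompactSupport_parityPart f N r') (hpM r') (v r r')).trans ?_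
      rw [hB]
      gcongr
      exact hv r hr r' hr'
    · simp [card_bits]
  refine (Finset.abs_sum_le_sum_abs _ _).trans ((Finset.sum_le_card_nsmul _ _ _ hterm).trans ?_)
  simp [card_bits]

end DyadicDensity

/-! ### The strong charge functional as a limit of dyadic densities. -/

section LimitFunctional

variable {d : ℕ}

lemma BV.integrable (u : BV d) : Integrable (u.toL1 : Space d → ℝ) := L1.integrable_coeFn _

lemma BV.ae_eq_zero (u : BV d) : ∀ᵐ x, x ∉ cube d → u.toL1 x = 0 := u.2.1

lemma BV.toReal_variation_le_norm (u : BV d) : (variation u.toL1).toReal ≤ ‖u‖ :=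
  le_add_of_nonneg_left (norm_nonneg _)

lemma BV.norm_toL1_le_norm (u : BV d) : ‖u.toL1‖ ≤ ‖u‖ :=
  le_add_of_nonneg_right ENNReal.toReal_nonneg

lemma measurableSet_cube : MeasurableSet (cube d) := isCompact_cube.measurableSet

/-- Integration against a bounded function is an element of the range of `T`. -/
lemma exists_mem_rangeT {g : Space d → ℝ} (hg : Measurable g) {M : ℝ} (hM : ∀ x, |g x| ≤ M) :
    ∃ α ∈ rangeT d, (∀ u : BV d, α u = ∫ x, u.toL1 x * g x) ∧
      ∀ u : BV d, |α u| ≤ M * ‖u.toL1‖ := by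
  have hi : ∀ u : BV d, Integrable fun x => u.toL1 x * g x := fun u =>
    u.integrable.mul_bdd hg.aestronglyMeasurable (Eventually.of_forall hM)
  let L : BV d →ₗ[ℝ] ℝ :=
    { toFun := fun u => ∫ x, u.toL1 x * g x
      map_add' := fun u w => by
        rw [← integral_add (hi u) (hi w)]
        refine integral_congr_ae ?_
        rw [map_add]
        filter_upwards [Lp.coeFn_add u.toL1 w.toL1] with x hx
        rw [hx, Pi.add_apply, add_mul]
      map_smul' := fun c u => by
        rw [RingHom.id_apply, smul_eq_mul, ← integral_const_mul]
        refine integral_congr_ae ?_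
        rw [map_smul]
        filter_upwards [Lp.coeFn_smul c u.toL1] with x hx
        rw [hx, Pi.smul_apply, smul_eq_mul, mul_assoc] }
  have hL : ∀ u, ‖L u‖ ≤ M * ‖u.toL1‖ := fun u => by
    have h1 : ‖L u‖ ≤ ∫ x, ‖u.toL1 x‖ * M := by
      refine norm_integral_le_of_norm_le (u.integrable.norm.mul_const M)
        (Eventually.of_forall fun x => ?_)
      rw [norm_mul]
      exact mul_le_mul_of_nonneg_left (hM x) (norm_nonneg _)
    rwa [integral_mul_const, ← L1.norm_eq_integral_norm, mul_comm] at h1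
  have hL' : ∀ u, ‖L u‖ ≤ M * ‖u‖ := fun u =>
    (hL u).trans (mul_le_mul_of_nonneg_left u.norm_toL1_le_norm ((abs_nonneg _).trans (hM 0)))
  refine ⟨L.mkContinuous M hL', ⟨g, ?_, fun u => ?_⟩, fun u => rfl, hL⟩
  · have : IsFiniteMeasure (volume.restrict (cube d)) :=
      ⟨by simpa using volume_cube_lt_top d⟩
    exact MemLp.of_bound hg.aestronglyMeasurable M (Eventually.of_forall hM)
  · simp only [mul_comm (g _)]
    refine ⟨(hi u).integrableOn, ?_⟩
    symm
    refine setIntegral_eq_integral_of_ae_compl_eq_zero ?_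
    filter_upwards [u.ae_eq_zero] with x hx hxc
    rw [hx hxc, zero_mul]

/-- If the increments over the cubes of generation `n` are at most `c θ ^ n`, with
`2 ^ (d - 1) θ < 1`, then the functionals given by the dyadic densities converge to a strong charge
functional. -/
lemma exists_tendsto_cellDensity {f : (Fin d → unitInterval) → ℝ} {c θ : ℝ} (hc : 0 ≤ c)
    (hθ : 0 ≤ θ) (hθ1 : 2 ^ d * θ / 2 < 1)
    (hf : ∀ n (k : Fin d → Fin (2 ^ n)), |increment f (dyadicCube n k)| ≤ c * θ ^ n) :
    ∃ (T : ℕ → StrongDual ℝ (BV d)) (α : StrongDual ℝ (BV d)), α ∈ SCH d ∧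
      Tendsto T atTop (𝓝 α) ∧ (∀ n, ∃ M, ∀ u, |T n u| ≤ M * ‖u.toL1‖) ∧
      ∀ n (u : BV d), T n u = ∫ x, u.toL1 x * cellDensity f n (cellIndex n x) := by
  have hM : ∀ n j, |cellDensity f n j| ≤ c * (2 ^ d * θ) ^ n := fun n j => by
    rw [cellDensity, abs_mul, abs_of_pos (by positivity), mul_pow, mul_left_comm]
    exact mul_le_mul_of_nonneg_left (abs_cellIncrement_le (by positivity) (hf n) j)
      (by positivity)
  choose T hT hT' hTM using fun n => exists_mem_rangeT
    (measurable_comp_cellIndex (cellDensity f n) n) (fun x => hM n (cellIndex n x))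
  -- The sup bound `c (2 ^ d θ) ^ (n + 1)` times the translation length `√d / 2 ^ (n + 1)` is
  -- geometric with ratio `2 ^ d θ / 2 < 1`.
  have hcauchy : CauchySeq T := by
    refine cauchySeq_of_le_geometric (2 ^ d * θ / 2)
      (2 ^ d * c * √d * (2 ^ d * θ / 2)) hθ1 fun n => ?_
    rw [dist_eq_norm_sub', ← neg_sub, norm_neg, ← neg_sub, norm_neg]
    refine ContinuousLinearMap.opNorm_le_bound _ (by positivity) fun u => ?_
    have hi : ∀ m, Integrable fun x => u.toL1 x * cellDensity f m (cellIndex m x) := fun m =>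
      u.integrable.mul_bdd (measurable_comp_cellIndex _ m).aestronglyMeasurable
        (Eventually.of_forall fun x => hM m _)
    have h1 := abs_integral_mul_cellDensity_sub_le f n (hM (n + 1)) u.integrable
      u.variation_ne_top
    simp only [mul_sub] at h1
    rw [integral_sub (hi _) (hi _), ← hT', ← hT'] at h1
    rw [sub_apply, Real.norm_eq_abs]
    refine h1.trans ?_
    have h2 := mul_le_mul_of_nonneg_left u.toReal_variation_le_norm
      (show 0 ≤ 2 ^ d * c * √d * (2 ^ d * θ / 2) * (2 ^ d * θ / 2) ^ n by positivity)
    refine le_trans (le_of_eq ?_) h2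
    rw [div_pow (2 ^ d * θ) 2 n, pow_succ (2 ^ d * θ) n, pow_succ (2 : ℝ) n]
    field_simp
  obtain ⟨α, hα⟩ := cauchySeq_tendsto_of_complete hcauchy
  exact ⟨T, α, mem_closure_of_tendsto hα (Eventually.of_forall hT), hα, fun n => ⟨_, hTM n⟩, hT'⟩

end LimitFunctional

/-! ### From functionals on `BV` to charges. -/

section Charges

variable {d : ℕ}

lemma BVSet.coeFn_ind (B : BVSet d) :
    B.ind.toL1 =ᵐ[volume] B.carrier.indicator fun _ => (1 : ℝ) :=
  (memLp_one_iff_integrable.2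
    (integrable_indicator B.subset_cube B.nullMeasurableSet)).coeFn_toLp

lemma BVSet.ind_eq_add {B₁ B₂ B : BVSet d} (h : volume (B₁.carrier ∩ B₂.carrier) = 0)
    (hB : B.carrier = B₁.carrier ∪ B₂.carrier) : B.ind = B₁.ind + B₂.ind := by
  refine BV.toL1_injective (Lp.ext ?_)
  rw [map_add]
  filter_upwards [B.coeFn_ind, B₁.coeFn_ind, B₂.coeFn_ind, Lp.coeFn_add B₁.ind.toL1 B₂.ind.toL1,
    measure_eq_zero_iff_ae_notMem.1 h] with x h0 h1 h2 h3 h4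
  rw [h3, Pi.add_apply, h0, h1, h2, hB]
  by_cases hx1 : x ∈ B₁.carrier <;> by_cases hx2 : x ∈ B₂.carrier <;> simp_all

lemma BVSet.toL1_ind_sub (B₁ B₂ : BVSet d) :
    ‖(B₁.ind - B₂.ind).toL1‖ = volume.real (B₁.carrier ∆ B₂.carrier) := by
  have hm : NullMeasurableSet (B₁.carrier ∆ B₂.carrier) volume :=
    (B₁.nullMeasurableSet.diff B₂.nullMeasurableSet).union
      (B₂.nullMeasurableSet.diff B₁.nullMeasurableSet)
  rw [L1.norm_eq_integral_norm, map_sub]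
  have h : (fun x => ‖(B₁.ind.toL1 - B₂.ind.toL1) x‖) =ᵐ[volume]
      (B₁.carrier ∆ B₂.carrier).indicator fun _ => (1 : ℝ) := by
    filter_upwards [B₁.coeFn_ind, B₂.coeFn_ind, Lp.coeFn_sub B₁.ind.toL1 B₂.ind.toL1]
      with x h1 h2 h3
    rw [h3, Pi.sub_apply, h1, h2]
    by_cases hx1 : x ∈ B₁.carrier <;> by_cases hx2 : x ∈ B₂.carrier <;>
      simp [hx1, hx2, Set.mem_symmDiff]
  rw [integral_congr_ae h, integral_indicator₀ hm]
  simp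

lemma BVSet.norm_ind_le (B : BVSet d) :
    ‖B.ind‖ ≤ volume.real (cube d) + (perimeter B.carrier).toReal := by
  rw [BV.norm_def, variation_congr B.coeFn_ind]
  refine add_le_add ?_ le_rfl
  rw [L1.norm_eq_integral_norm]
  have h : (fun x => ‖B.ind.toL1 x‖) =ᵐ[volume] B.carrier.indicator fun _ => (1 : ℝ) := by
    filter_upwards [B.coeFn_ind] with x hx
    rw [hx]
    by_cases hx1 : x ∈ B.carrier <;> simp [hx1]
  rw [integral_congr_ae h, integral_indicator₀ B.nullMeasurableSet]
  simpa using measureReal_mono B.subset_cube (volume_cube_lt_top d).ne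

/-- A norm limit of functionals that are continuous for the `L¹` norm restricts to a charge. -/
lemma isCharge_of_tendsto {T : ℕ → StrongDual ℝ (BV d)} {α : StrongDual ℝ (BV d)}
    (hT : Tendsto T atTop (𝓝 α)) (hM : ∀ n, ∃ M, ∀ u, |T n u| ≤ M * ‖u.toL1‖) :
    IsCharge fun B : BVSet d => α B.ind := by
  refine ⟨fun B₁ B₂ B h hB => by rw [BVSet.ind_eq_add h hB, map_add], fun B B' hB hlim => ?_⟩
  -- A common `BV` bound for the sequence and its limit; the summand `1` in the witness makes it
  -- positive, so that `ε / (3 * P)` makes sense.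
  obtain ⟨P, hP0, hP, hP'⟩ : ∃ P, 0 < P ∧ (∀ n, ‖(B n).ind‖ ≤ P) ∧ ‖B'.ind‖ ≤ P := by
    refine ⟨volume.real (cube d) + (⨆ n, perimeter (B n).carrier).toReal + ‖B'.ind‖ + 1,
      by positivity, fun n => ?_, ?_⟩
    · have h1 := (B n).norm_ind_le
      have h2 := ENNReal.toReal_mono hB.ne (le_iSup (fun n => perimeter (B n).carrier) n)
      have := norm_nonneg B'.ind
      linarith
    · have := measureReal_nonneg (μ := volume) (s := cube d)
      have := ENNReal.toReal_nonneg (a := ⨆ n, perimeter (B n).carrier)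
      linarith
  rw [Metric.tendsto_atTop]
  intro ε hε
  obtain ⟨m, hm⟩ := (Metric.tendsto_atTop.1 hT (ε / (3 * P)) (by positivity))
  have hm := hm m le_rfl
  rw [dist_eq_norm_sub', lt_div_iff₀ (by positivity)] at hm
  obtain ⟨M, hM⟩ := hM m
  have hlim' : Tendsto (fun n => M * ‖((B n).ind - B'.ind).toL1‖) atTop (𝓝 0) := by
    simp only [BVSet.toL1_ind_sub]
    have := (ENNReal.tendsto_toReal ENNReal.zero_ne_top).comp hlim
    simpa [measureReal_def] using this.const_mul M
  obtain ⟨n₀, hn₀⟩ := eventually_atTop.1 (hlim'.eventually (gt_mem_nhds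
    (show (0 : ℝ) < ε / 3 by positivity)))
  refine ⟨n₀, fun n hn => ?_⟩
  have h1 := hn₀ n hn
  have h2 := hM ((B n).ind - B'.ind)
  have h3 := (α - T m).le_opNorm (B n).ind
  have h4 := (α - T m).le_opNorm B'.ind
  have h5 := mul_le_mul_of_nonneg_left (hP n) (norm_nonneg (α - T m))
  have h6 := mul_le_mul_of_nonneg_left hP' (norm_nonneg (α - T m))
  rw [sub_apply, Real.norm_eq_abs] at h3 h4
  rw [map_sub] at h2
  rw [Real.dist_eq]
  -- An `ε / 3` argument: the outer terms are small because `α - T m` is small in norm, the middle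
  -- one because `T m` is continuous in `L¹`.
  have h7 : α (B n).ind - α B'.ind = (α (B n).ind - T m (B n).ind) +
      (T m (B n).ind - T m B'.ind) - (α B'.ind - T m B'.ind) := by ring
  rw [h7]
  refine (abs_sub _ _).trans_lt ?_
  have h8 := abs_add_le (α (B n).ind - T m (B n).ind) (T m (B n).ind - T m B'.ind)
  nlinarith

/-- By linearity of `α`, this reduces the extension property on figures to single rectangles. -/
lemma ind_figure {n : ℕ} (K : Fin n → Rect d)
    (hK : Pairwise fun i j => volume ((K i).toSet ∩ (K j).toSet) = 0) :
    (figure K hK).ind = ∑ i, (K i).toBVSet.ind := by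
  refine BV.toL1_injective (Lp.ext ?_)
  rw [map_sum]
  have h0 : ∀ᵐ x : Space d, ∀ i j, i ≠ j → x ∉ (K i).toSet ∩ (K j).toSet := by
    simp only [ae_all_iff]
    exact fun i j hij => measure_eq_zero_iff_ae_notMem.1 (hK hij)
  have h1 : ∀ᵐ x : Space d, ∀ i, (K i).toBVSet.ind.toL1 x =
      (K i).toSet.indicator (fun _ => (1 : ℝ)) x :=
    ae_all_iff.2 fun i => (K i).toBVSet.coeFn_ind
  have h2 := Lp.coeFn_finsetSum (Finset.univ) fun i => (K i).toBVSet.ind.toL1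
  filter_upwards [h0, h1, h2, (figure K hK).coeFn_ind] with x hx hx1 hx2 hx3
  rw [hx2, hx3, Finset.sum_apply]
  simp only [hx1]
  change (⋃ i, (K i).toSet).indicator (fun _ => (1 : ℝ)) x = _
  by_cases hxu : x ∈ ⋃ i, (K i).toSet
  · obtain ⟨i, hi⟩ := Set.mem_iUnion.1 hxu
    rw [Set.indicator_of_mem hxu, Finset.sum_eq_single i, Set.indicator_of_mem hi]
    · intro j _ hji
      exact Set.indicator_of_notMem (fun hj => hx j i hji ⟨hj, hi⟩) _
    · simp
  · rw [Set.indicator_of_notMem hxu]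
    refine (Finset.sum_eq_zero fun i _ => ?_).symm
    exact Set.indicator_of_notMem (fun hi => hxu (Set.mem_iUnion.2 ⟨i, hi⟩)) _

end Charges

/-! ### Perimeters, cells, and dyadic approximation of rectangles. -/

section Rectangles

variable {d : ℕ}

/-- By the divergence theorem the perimeter is at most the total area of the `2 d` faces, each of
area at most `1` inside the unit cube. Uniformity in `K` makes approximating sequences of rectangles
bounded in `BV`. -/
lemma Rect.perimeter_le (K : Rect d) : perimeter K.toSet ≤ ENNReal.ofReal (2 * d) := by
  rcases d with _ | n
  · simp [perimeter, variation, divergence]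
  set a : Fin (n + 1) → ℝ := fun i => (K.lo i : ℝ) with ha
  set b : Fin (n + 1) → ℝ := fun i => (K.hi i : ℝ) with hb
  have hab : a ≤ b := fun i => (K.lo_lt_hi i).le
  refine iSup₂_le fun φ hφ => ENNReal.ofReal_le_ofReal ?_
  have h1 : ∫ x, K.toSet.indicator (fun _ => (1 : ℝ)) x * divergence φ x =
      ∫ y in Set.Icc a b, divergence φ (WithLp.toLp 2 y) := by
    have h2 : (fun x => K.toSet.indicator (fun _ => (1 : ℝ)) x * divergence φ x) =
        K.toSet.indicator (divergence φ) := by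
      ext x
      by_cases hx : x ∈ K.toSet <;> simp [hx]
    rw [h2, integral_indicator K.measurableSet, K.toSet_eq_preimage]
    exact (PiLp.volume_preserving_ofLp (Fin (n + 1))).setIntegral_preimage_emb
      (MeasurableEquiv.toLp 2 (Fin (n + 1) → ℝ)).symm.measurableEmbedding
      (fun y => divergence φ (WithLp.toLp 2 y)) (Set.Icc a b)
  let e : (Fin (n + 1) → ℝ) →L[ℝ] Space (n + 1) :=
    ((EuclideanSpace.equiv (Fin (n + 1)) ℝ).symm : (Fin (n + 1) → ℝ) →L[ℝ] Space (n + 1))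
  have hφc : Continuous φ := hφ.contDiff.continuous
  have hdiv := integral_divergence_of_hasFDerivAt_off_countable' a b hab
    (fun i y => φ (e y) i)
    (fun i y => ((EuclideanSpace.proj i : Space (n + 1) →L[ℝ] ℝ).comp (fderiv ℝ φ (e y))).comp e)
    ∅ Set.countable_empty (fun i => by fun_prop)
    (fun y _ i => (EuclideanSpace.proj i : Space (n + 1) →L[ℝ] ℝ).hasFDerivAt.comp y
      ((hφ.contDiff.differentiable one_ne_zero (e y)).hasFDerivAt.comp y e.hasFDerivAt))
    ((hφ.continuous_divergence.comp e.continuous).continuousOn.integrableOn_compact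
      isCompact_Icc)
  have h5 : ∫ y in Set.Icc a b, divergence φ (WithLp.toLp 2 y) = _ := hdiv
  rw [h1, h5]
  have hbound : ∀ (i : Fin (n + 1)) (y : Fin (n + 1) → ℝ), ‖φ (e y) i‖ ≤ 1 := fun i y =>
    (PiLp.norm_apply_le (φ (e y)) i).trans (hφ.norm_le_one _)
  refine (Finset.sum_le_card_nsmul _ _ 2 fun i _ => ?_).trans_eq (by simp [mul_comm])
  have hfin : volume (Set.Icc (a ∘ i.succAbove) (b ∘ i.succAbove)) < ∞ :=
    isCompact_Icc.measure_lt_top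
  have hvol : volume.real (Set.Icc (a ∘ i.succAbove) (b ∘ i.succAbove)) ≤ 1 := by
    rw [measureReal_def, Real.volume_Icc_pi_toReal (show a ∘ i.succAbove ≤ b ∘ i.succAbove from
      fun j => hab _)]
    refine Finset.prod_le_one (fun j _ => sub_nonneg.2 (hab _)) fun j _ => ?_
    have h8 := (K.hi (i.succAbove j)).2.2
    have h9 := (K.lo (i.succAbove j)).2.1
    simp only [Function.comp_apply, ha, hb]
    linarith
  have h6 := norm_setIntegral_le_of_norm_le_const hfin
    (f := fun y => φ (e (i.insertNth (b i) y)) i) (fun y _ => hbound i _)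
  have h7 := norm_setIntegral_le_of_norm_le_const hfin
    (f := fun y => φ (e (i.insertNth (a i) y)) i) (fun y _ => hbound i _)
  rw [Real.norm_eq_abs] at h6 h7
  refine (le_abs_self _).trans ((abs_sub _ _).trans ?_)
  linarith

lemma volume_real_dyadicCube (n : ℕ) (k : Fin d → Fin (2 ^ n)) :
    (dyadicCube n k).vol = ((2 ^ d)⁻¹) ^ n := by
  rw [Rect.vol, Rect.toSet_eq_preimage, measureReal_def,
    (PiLp.volume_preserving_ofLp (Fin d)).measure_preimage measurableSet_Icc.nullMeasurableSet,
    Real.volume_Icc_pi_toReal fun i => ((dyadicCube n k).lo_lt_hi i).le]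
  have h : ∀ i, (((dyadicCube n k).hi i : ℝ) - (dyadicCube n k).lo i) = (2 ^ n)⁻¹ := fun i => by
    simp only [dyadicCube]
    push_cast
    ring
  simp only [h, Finset.prod_const, Finset.card_univ, Fintype.card_fin, inv_pow, ← pow_mul, mul_comm]

lemma cellIndex_preimage_singleton (n : ℕ) (j : Fin d → ℤ) :
    cellIndex n ⁻¹' {j} = (WithLp.ofLp : Space d → (Fin d → ℝ)) ⁻¹'
      Set.univ.pi fun i => Set.Ico ((j i : ℝ) / 2 ^ n) (((j i : ℝ) + 1) / 2 ^ n) := by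
  have hp : (0 : ℝ) < 2 ^ n := by positivity
  ext x
  simp [funext_iff, cellIndex, Int.floor_eq_iff, div_le_iff₀' hp, lt_div_iff₀' hp]

lemma volume_real_cell (n : ℕ) (j : Fin d → ℤ) :
    (volume : Measure (Space d)).real (cellIndex n ⁻¹' {j}) = ((2 ^ d) ^ n)⁻¹ := by
  rw [cellIndex_preimage_singleton, measureReal_def,
    (PiLp.volume_preserving_ofLp (Fin d)).measure_preimage
      (MeasurableSet.univ_pi fun i => measurableSet_Ico).nullMeasurableSet, Real.volume_pi_Ico]
  have h : ∀ i, ((j i : ℝ) + 1) / 2 ^ n - (j i : ℝ) / 2 ^ n = (2 ^ n)⁻¹ := fun i => by ring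
  simp only [h, Finset.prod_const, Finset.card_univ, Fintype.card_fin, ENNReal.toReal_pow,
    ENNReal.toReal_ofReal (show (0 : ℝ) ≤ (2 ^ n)⁻¹ by positivity), inv_pow, ← pow_mul, mul_comm]

/-- The dyadic density of generation `n` integrates to the increment over every rectangle whose
vertices are dyadic of generation `n`. -/
lemma integral_ind_mul_cellDensity (f : (Fin d → unitInterval) → ℝ) {n : ℕ} {K : Rect d}
    {A B : Fin d → ℕ} (hA : ∀ i, (K.lo i : ℝ) = A i / 2 ^ n) (hB : ∀ i, (K.hi i : ℝ) = B i / 2 ^ n) :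
    ∫ x, K.toBVSet.ind.toL1 x * cellDensity f n (cellIndex n x) = increment f K := by
  have hp : (0 : ℝ) < 2 ^ n := by positivity
  have hB' : ∀ i, B i ≤ 2 ^ n := fun i => by
    have := (K.hi i).2.2
    rw [hB, div_le_one hp] at this
    exact_mod_cast this
  have hAB : ∀ i, A i ≤ B i := fun i => by
    have : (K.lo i : ℝ) < K.hi i := K.lo_lt_hi i
    rw [hA, hB, div_lt_div_iff_of_pos_right hp] at this
    exact_mod_cast this.le
  set R := Fintype.piFinset fun i => Finset.range (B i - A i) with hR
  have hinc : increment f K = ∑ r ∈ R, cellIncrement f n fun i => (A i : ℤ) + r i := by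
    have h := boxIncrement_grid f (fun i m => dyadicPoint n ((A i : ℤ) + (m : ℕ)))
      fun i => B i - A i
    have h1 : (fun i => dyadicPoint n ((A i : ℤ) + (0 : ℕ))) = K.lo := funext fun i => by
      rw [Nat.cast_zero, add_zero, dyadicPoint_natCast ((hAB i).trans (hB' i))]
      exact Subtype.ext (hA i).symm
    have h2 : (fun i => dyadicPoint n ((A i : ℤ) + ((B i - A i : ℕ) : ℤ))) = K.hi :=
      funext fun i => by
        rw [Nat.cast_sub (hAB i), add_sub_cancel, dyadicPoint_natCast (hB' i)]
        exact Subtype.ext (hB i).symm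
    rw [h1, h2] at h
    refine Eq.trans h (Finset.sum_congr rfl fun r _ => ?_)
    simp only [cellIncrement, Nat.cast_add, Nat.cast_one, add_assoc]
  -- The closed rectangle and the corresponding union of half-open cells differ by a null set.
  have hae : K.toSet =ᵐ[volume] {x : Space d | ∀ i, (A i : ℤ) ≤ cellIndex n x i ∧
      cellIndex n x i < B i} := by
    have h1 := (PiLp.volume_preserving_ofLp (Fin d)).quasiMeasurePreserving.preimage_ae_eq
      (Measure.univ_pi_Ico_ae_eq_Icc (μ := fun _ : Fin d => (volume : Measure ℝ))
        (f := fun i => (K.lo i : ℝ)) (g := fun i => (K.hi i : ℝ)))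
    rw [K.toSet_eq_preimage]
    refine h1.symm.trans (Eventually.of_forall fun x => propext ?_)
    change _ ∈ Set.univ.pi _ ↔ ∀ i, _
    simp [cellIndex, hA, hB, Int.le_floor, Int.floor_lt, div_le_iff₀' hp, lt_div_iff₀' hp]
  have hcell : ∀ j : Fin d → ℤ, MeasurableSet (cellIndex (d := d) n ⁻¹' {j}) := fun j =>
    measurable_cellIndex n (measurableSet_singleton j)
  have hpt : ∀ᵐ x : Space d, K.toBVSet.ind.toL1 x * cellDensity f n (cellIndex n x) =
      ∑ r ∈ R, (cellIndex n ⁻¹' {fun i => (A i : ℤ) + r i}).indicator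
        (fun _ => cellDensity f n fun i => (A i : ℤ) + r i) x := by
    filter_upwards [K.toBVSet.coeFn_ind, hae.mem_iff] with x hx1 hx2
    rw [hx1]
    change K.toSet.indicator _ x * _ = _
    by_cases hx : x ∈ K.toSet
    · have hx3 : ∀ i, (A i : ℤ) ≤ cellIndex n x i ∧ cellIndex n x i < B i := hx2.1 hx
      have h4 : (fun i => (A i : ℤ) + ((cellIndex n x i - A i).toNat : ℕ)) = cellIndex n x :=
        funext fun i => by have := hx3 i; lia
      rw [Finset.sum_eq_single fun i => (cellIndex n x i - A i).toNat, h4]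
      · simp [hx]
      · intro r _ hr
        refine Set.indicator_of_notMem (fun h => hr (funext fun i => ?_)) _
        have := congrFun (Set.mem_singleton_iff.1 h) i
        lia
      · refine fun h => absurd (Fintype.mem_piFinset.2 fun i => ?_) h
        have := hx3 i
        rw [Finset.mem_range]
        lia
    · rw [Set.indicator_of_notMem hx, zero_mul]
      refine (Finset.sum_eq_zero fun r hr => Set.indicator_of_notMem (fun h => hx (hx2.2 ?_)) _).symm
      intro i
      have h1 := congrFun (Set.mem_singleton_iff.1 h) i
      have h2 := Finset.mem_range.1 (Fintype.mem_piFinset.1 hr i)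
      lia
  have hfin : ∀ j : Fin d → ℤ, volume (cellIndex (d := d) n ⁻¹' {j}) ≠ ∞ := fun j h => by
    have := volume_real_cell n j
    rw [measureReal_def, h] at this
    have h2 : (0 : ℝ) < ((2 ^ d) ^ n)⁻¹ := by positivity
    exact h2.ne this
  rw [integral_congr_ae hpt, integral_finsetSum, hinc]
  · refine Finset.sum_congr rfl fun r _ => ?_
    rw [integral_indicator (hcell _), setIntegral_const, volume_real_cell, cellDensity,
      smul_eq_mul, inv_mul_cancel_left₀ (by positivity)]
  · exact fun r _ => (integrable_indicator_iff (hcell _)).2 (integrableOn_const (hfin _))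

/-- The smallest rectangle with dyadic vertices of generation `n` that contains `K`. -/
noncomputable def Rect.dyadicHull (K : Rect d) (n : ℕ) : Rect d where
  lo i := ⟨(⌊(K.lo i : ℝ) * 2 ^ n⌋₊ : ℝ) / 2 ^ n, dyadic_mem (by
    refine Nat.floor_le_of_le ?_
    push_cast
    exact mul_le_of_le_one_left (by positivity) (K.lo i).2.2)⟩
  hi i := ⟨(⌈(K.hi i : ℝ) * 2 ^ n⌉₊ : ℝ) / 2 ^ n, dyadic_mem (by
    refine Nat.ceil_le.2 ?_
    push_cast
    exact mul_le_of_le_one_left (by positivity) (K.hi i).2.2)⟩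
  lo_lt_hi i := by
    rw [Subtype.mk_lt_mk]
    have hp : (0 : ℝ) < 2 ^ n := by positivity
    rw [div_lt_div_iff_of_pos_right hp]
    have h : (K.lo i : ℝ) < K.hi i := K.lo_lt_hi i
    exact (Nat.floor_le (mul_nonneg (K.lo i).2.1 hp.le)).trans_lt
      ((mul_lt_mul_of_pos_right h hp).trans_le (Nat.le_ceil _))

lemma tendsto_two_pow : Tendsto (fun n : ℕ => (2 : ℝ) ^ n) atTop atTop :=
  tendsto_pow_atTop_atTop_of_one_lt one_lt_two

lemma Rect.tendsto_dyadicHull_lo (K : Rect d) (i : Fin d) :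
    Tendsto (fun n => ((K.dyadicHull n).lo i : ℝ)) atTop (𝓝 (K.lo i)) :=
  (tendsto_nat_floor_mul_div_atTop (K.lo i).2.1).comp tendsto_two_pow

lemma Rect.tendsto_dyadicHull_hi (K : Rect d) (i : Fin d) :
    Tendsto (fun n => ((K.dyadicHull n).hi i : ℝ)) atTop (𝓝 (K.hi i)) :=
  (tendsto_nat_ceil_mul_div_atTop (K.hi i).2.1).comp tendsto_two_pow

lemma Rect.toSet_subset_dyadicHull (K : Rect d) (n : ℕ) : K.toSet ⊆ (K.dyadicHull n).toSet := by
  have hp : (0 : ℝ) < 2 ^ n := by positivity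
  refine fun x hx i => ⟨le_trans ?_ (hx i).1, (hx i).2.trans ?_⟩
  · exact (div_le_iff₀ hp).2 (Nat.floor_le (mul_nonneg (K.lo i).2.1 hp.le))
  · exact (le_div_iff₀ hp).2 (Nat.le_ceil _)

/-- The indicators of the symmetric differences tend to `0` at every point: the hulls contain `K`,
and a point outside `K` violates some inequality strictly, hence also for the nearby endpoints of
late hulls. -/
lemma Rect.tendsto_volume_symmDiff_dyadicHull (K : Rect d) :
    Tendsto (fun n => volume ((K.dyadicHull n).toSet ∆ K.toSet)) atTop (𝓝 0) := by
  rw [← measure_empty (μ := (volume : Measure (Space d)))]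
  refine tendsto_measure_of_tendsto_indicator atTop
    (fun n => (K.dyadicHull n).measurableSet.symmDiff K.measurableSet) measurableSet_cube
    (volume_cube_lt_top d).ne (Eventually.of_forall fun n x hx => ?_) fun x => ?_
  · rcases hx with hx | hx
    exacts [Rect.subset_cube _ hx.1, Rect.subset_cube _ hx.1]
  · by_cases hx : x ∈ K.toSet
    · exact Eventually.of_forall fun n => by
        simp [Set.mem_symmDiff, hx, K.toSet_subset_dyadicHull n hx]
    · have h : ∀ᶠ n in atTop, x ∉ (K.dyadicHull n).toSet := by
        have hx' : ∃ i, x i < K.lo i ∨ K.hi i < x i := by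
          by_contra! h
          exact hx h
        obtain ⟨i, hi | hi⟩ := hx'
        · filter_upwards [(K.tendsto_dyadicHull_lo i).eventually (lt_mem_nhds hi)] with n hn hmem
          exact absurd (hmem i).1 hn.not_ge
        · filter_upwards [(K.tendsto_dyadicHull_hi i).eventually (gt_mem_nhds hi)] with n hn hmem
          exact absurd (hmem i).2 hn.not_ge
      filter_upwards [h] with n hn
      simp [Set.mem_symmDiff, hx, hn]

lemma tendsto_increment_dyadicHull {f : (Fin d → unitInterval) → ℝ} (hf : Continuous f)
    (K : Rect d) : Tendsto (fun n => increment f (K.dyadicHull n)) atTop (𝓝 (increment f K)) := by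
  refine tendsto_finsetSum _ fun s _ => ((hf.tendsto _).comp ?_).const_mul _
  refine tendsto_pi_nhds.2 fun i => tendsto_subtype_rng.2 ?_
  by_cases hi : i ∈ s
  · simpa only [if_pos hi] using K.tendsto_dyadicHull_lo i
  · simpa only [if_neg hi] using K.tendsto_dyadicHull_hi i

end Rectangles

/-! ### The deterministic criterion and the moment estimate. -/

section Chargeability

variable {d : ℕ}

lemma isHolderStronglyChargeable_of_increment_le {f : (Fin d → unitInterval) → ℝ}
    (hd : 1 ≤ d) (hf : Continuous f) {γ c : ℝ} (hγ : ((d : ℝ) - 1) / d < γ) (hc : 0 ≤ c)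
    (h : ∀ n (k : Fin d → Fin (2 ^ n)),
      |increment f (dyadicCube n k)| ≤ c * (dyadicCube n k).vol ^ γ) :
    IsHolderStronglyChargeable γ f := by
  set θ : ℝ := ((2 ^ d)⁻¹ : ℝ) ^ γ with hθ
  -- Here the threshold enters: `2 ^ d θ = 2 ^ (d (1 - γ))` is less than `2` exactly when `γ > (d -
  -- 1) / d`.
  have hθ1 : 2 ^ d * θ / 2 < 1 := by
    have hd0 : (0 : ℝ) < d := by exact_mod_cast hd
    rw [div_lt_iff₀ hd0] at hγ
    have h1 : (2 : ℝ) ^ d * θ = 2 ^ ((d : ℝ) * (1 - γ)) := by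
      rw [hθ, Real.inv_rpow (by positivity), ← Real.rpow_natCast, ← Real.rpow_mul (by positivity),
        ← Real.rpow_neg (by positivity), ← Real.rpow_add (by positivity)]
      congr 1
      ring
    rw [h1, div_lt_one two_pos]
    refine (Real.rpow_lt_rpow_of_exponent_lt one_lt_two
      (show (d : ℝ) * (1 - γ) < 1 by linarith)).trans_eq (Real.rpow_one 2)
  obtain ⟨T, α, hα, hT, hTM, hTint⟩ := exists_tendsto_cellDensity hc
    (by positivity : 0 ≤ θ) hθ1 fun n k => by
      have := h n k
      rwa [volume_real_dyadicCube, ← Real.rpow_pow_comm (by positivity)] at this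
  have hcharge := isCharge_of_tendsto hT hTM
  -- Along the dyadic hulls `K_n` of `K`, `α` converges by the charge property and `T n` gives the
  -- increment over `K_n`, which converges as `f` is continuous. The two limits agree because `‖T n
  -- - α‖ → 0` and the hulls are bounded in `BV`.
  have hrect : ∀ K : Rect d, α K.toBVSet.ind = increment f K := fun K => by
    have h1 : Tendsto (fun n => α (K.dyadicHull n).toBVSet.ind) atTop (𝓝 (α K.toBVSet.ind)) :=
      hcharge.continuous (fun n => (K.dyadicHull n).toBVSet) K.toBVSet
        ((iSup_le fun n => (K.dyadicHull n).perimeter_le).trans_lt ENNReal.ofReal_lt_top)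
        K.tendsto_volume_symmDiff_dyadicHull
    have h2 : Tendsto (fun n => T n (K.dyadicHull n).toBVSet.ind) atTop
        (𝓝 (increment f K)) := by
      refine (tendsto_increment_dyadicHull hf K).congr fun n => ?_
      rw [hTint, integral_ind_mul_cellDensity f (fun i => rfl) fun i => rfl]
    have h3 : Tendsto (fun n => α (K.dyadicHull n).toBVSet.ind -
        T n (K.dyadicHull n).toBVSet.ind) atTop (𝓝 0) := by
      set P := volume.real (cube d) + 2 * d with hP
      have h4 : Tendsto (fun n => ‖T n - α‖ * P) atTop (𝓝 0) := by
        simpa using (tendsto_iff_norm_sub_tendsto_zero.1 hT).mul_const P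
      refine squeeze_zero_norm (fun n => ?_) h4
      rw [← sub_apply, norm_sub_rev (T n)]
      refine ((α - T n).le_opNorm _).trans (mul_le_mul_of_nonneg_left ?_ (norm_nonneg _))
      refine (BVSet.norm_ind_le _).trans (add_le_add le_rfl ?_)
      exact ENNReal.toReal_le_of_le_ofReal (by positivity) (K.dyadicHull n).perimeter_le
    have h5 := tendsto_nhds_unique (h1.sub h2) h3
    linarith
  refine ⟨fun B => α B.ind, ⟨hcharge, α, hα, fun B => rfl⟩, fun n K hK => ?_, c, hc, fun n k => ?_⟩
  · simp only [ind_figure, map_sum, hrect]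
  · simp only [hrect]
    exact h n k

/-- Summing `q`-th powers over all cubes with weight `|K| ^ (-γ q)` gives a random variable of
finite expectation; its `q`-th root serves as the Hölder constant. -/
lemma ae_increment_le {Ω : Type*} [MeasurableSpace Ω] {P : Measure Ω}
    {X : (Fin d → unitInterval) → Ω → ℝ} (hX : ∀ t, Measurable (X t)) {q C δ γ : ℝ} (hd : 1 ≤ d)
    (hq : 0 < q) (hC : 0 ≤ C) (hγ : γ < δ / q)
    (hmoment : ∀ (n : ℕ) (k : Fin d → Fin (2 ^ n)),
      ∫⁻ ω, ENNReal.ofReal (|increment (fun t => X t ω) (dyadicCube n k)| ^ q) ∂P ≤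
        ENNReal.ofReal (C * (dyadicCube n k).vol ^ (1 + δ))) :
    ∀ᵐ ω ∂P, ∃ c : ℝ, 0 ≤ c ∧ ∀ n (k : Fin d → Fin (2 ^ n)),
      |increment (fun t => X t ω) (dyadicCube n k)| ≤ c * (dyadicCube n k).vol ^ γ := by
  simp only [volume_real_dyadicCube] at hmoment ⊢
  set β : ℝ := (2 ^ d)⁻¹ with hβ
  have hβ0 : 0 < β := by positivity
  have hβ1 : β < 1 := inv_lt_one_of_one_lt₀ (one_lt_pow₀ one_lt_two (by lia))
  have hmeas : ∀ n (k : Fin d → Fin (2 ^ n)), Measurable fun ω =>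
      ENNReal.ofReal (|increment (fun t => X t ω) (dyadicCube n k)| ^ q) := fun n k => by
    refine ENNReal.measurable_ofReal.comp (Measurable.pow_const ?_ q)
    refine Measurable.abs (Finset.measurable_fun_sum _ fun s _ => (hX _).const_mul _)
  let S : Ω → ℝ≥0∞ := fun ω => ∑' n, ∑ k : Fin d → Fin (2 ^ n),
    ENNReal.ofReal (|increment (fun t => X t ω) (dyadicCube n k)| ^ q) *
      ENNReal.ofReal ((β ^ n) ^ (-(γ * q)))
  have hS : Measurable S := Measurable.tsum fun n =>
    Finset.measurable_fun_sum _ fun k _ => (hmeas n k).mul_const _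
  -- The expected contribution of generation `n` is at most `C ρ ^ n`, and `γ < δ / q` gives `ρ <
  -- 1`.
  set ρ := β ^ (δ - γ * q) with hρ
  have hρ1 : ρ < 1 := Real.rpow_lt_one hβ0.le hβ1 (sub_pos.2 ((lt_div_iff₀ hq).1 hγ))
  have hρ0 : 0 ≤ ρ := by positivity
  have hterm : ∀ n, ∫⁻ ω, (∑ k : Fin d → Fin (2 ^ n),
      ENNReal.ofReal (|increment (fun t => X t ω) (dyadicCube n k)| ^ q) *
        ENNReal.ofReal ((β ^ n) ^ (-(γ * q)))) ∂P ≤ ENNReal.ofReal (C * ρ ^ n) := fun n => by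
    rw [lintegral_finsetSum _ fun k _ => (hmeas n k).mul_const _]
    have h1 : ∀ k : Fin d → Fin (2 ^ n), ∫⁻ ω,
        ENNReal.ofReal (|increment (fun t => X t ω) (dyadicCube n k)| ^ q) *
          ENNReal.ofReal ((β ^ n) ^ (-(γ * q))) ∂P ≤
        ENNReal.ofReal (β ^ n * (C * ρ ^ n)) := fun k => by
      rw [lintegral_mul_const _ (hmeas n k)]
      refine (mul_le_mul_left (hmoment n k) _).trans_eq ?_
      rw [← ENNReal.ofReal_mul (by positivity)]
      congr 1
      rw [hρ, Real.rpow_pow_comm hβ0.le, mul_assoc, ← Real.rpow_add (by positivity),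
        mul_left_comm]
      congr 1
      nth_rw 2 [← Real.rpow_one (β ^ n)]
      rw [← Real.rpow_add (by positivity)]
      congr 1
      ring
    refine (Finset.sum_le_sum fun k _ => h1 k).trans_eq ?_
    rw [Finset.sum_const, Finset.card_univ, Fintype.card_fun, Fintype.card_fin, Fintype.card_fin,
      nsmul_eq_mul, ← ENNReal.ofReal_natCast, ← ENNReal.ofReal_mul (by positivity), ← mul_assoc]
    -- The `1` in the exponent `1 + δ` exactly pays for the number of cubes of generation `n`.
    have h2 : (((2 ^ n) ^ d : ℕ) : ℝ) * β ^ n = 1 := by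
      rw [hβ]
      push_cast
      rw [← pow_mul, mul_comm n d, pow_mul, inv_pow, mul_inv_cancel₀ (by positivity)]
    rw [h2, one_mul]
  have hfin : ∫⁻ ω, S ω ∂P ≠ ∞ := by
    rw [lintegral_tsum fun n => (Finset.measurable_fun_sum _ fun k _ =>
      (hmeas n k).mul_const _).aemeasurable]
    refine ne_top_of_le_ne_top ?_ (ENNReal.tsum_le_tsum hterm)
    rw [← ENNReal.ofReal_tsum_of_nonneg (fun n => by positivity)
      ((summable_geometric_of_lt_one hρ0 hρ1).mul_left C)]
    exact ENNReal.ofReal_ne_top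
  filter_upwards [ae_lt_top hS hfin] with ω hω
  refine ⟨(S ω).toReal ^ q⁻¹, by positivity, fun n k => ?_⟩
  set y := |increment (fun t => X t ω) (dyadicCube n k)| with hy
  have h1 : ENNReal.ofReal (y ^ q) * ENNReal.ofReal ((β ^ n) ^ (-(γ * q))) ≤ S ω :=
    (Finset.single_le_sum (f := fun k : Fin d → Fin (2 ^ n) =>
      ENNReal.ofReal (|increment (fun t => X t ω) (dyadicCube n k)| ^ q) *
        ENNReal.ofReal ((β ^ n) ^ (-(γ * q)))) (fun _ _ => zero_le) (Finset.mem_univ k)).trans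
      (ENNReal.le_tsum (f := fun n => ∑ k : Fin d → Fin (2 ^ n),
        ENNReal.ofReal (|increment (fun t => X t ω) (dyadicCube n k)| ^ q) *
          ENNReal.ofReal ((β ^ n) ^ (-(γ * q)))) n)
  rw [← ENNReal.ofReal_mul (by positivity), ENNReal.ofReal_le_iff_le_toReal hω.ne,
    Real.rpow_neg (by positivity), ← div_eq_mul_inv, div_le_iff₀ (by positivity)] at h1
  rw [← Real.rpow_le_rpow_iff (abs_nonneg _) (by positivity) hq, Real.mul_rpow (by positivity)
    (by positivity), ← Real.rpow_mul (by positivity), ← Real.rpow_mul (by positivity),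
    inv_mul_cancel₀ hq.ne', Real.rpow_one]
  exact h1

end Chargeability

end StrongCharge

/-! ### The theorem. -/

open StrongCharge

theorem mainTheorem9 {Ω : Type*} [MeasurableSpace Ω] (P : Measure Ω) [IsProbabilityMeasure P]
    (d : ℕ) (hd : 1 ≤ d)
    (X : (Fin d → unitInterval) → Ω → ℝ)
    (hX_meas : ∀ t, Measurable (X t))
    (hX_cont : ∀ ω, Continuous fun t => X t ω)
    (q C δ : ℝ) (hq : 0 < q) (hC : 0 ≤ C) (hδ : 0 < δ)
    (hlow : ((d : ℝ) - 1) / d < δ / q) (hup : δ / q ≤ 1)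
    (hmoment : ∀ (n : ℕ) (k : Fin d → Fin (2 ^ n)),
      ∫⁻ ω, ENNReal.ofReal (|increment (fun t => X t ω) (dyadicCube n k)| ^ q) ∂P ≤
        ENNReal.ofReal (C * (dyadicCube n k).vol ^ (1 + δ))) :
    ∀ᵐ ω ∂P, ∀ γ : ℝ, ((d : ℝ) - 1) / d < γ → γ < δ / q →
      IsHolderStronglyChargeable γ fun t => X t ω := by
  -- The exceptional event must not depend on `γ`: the estimate is taken for the exponents `δ / q -
  -- 1 / (m + 1)` and passes to any smaller `γ` because dyadic cubes have volume at most `1`.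
  have h : ∀ m : ℕ, ∀ᵐ ω ∂P, ∃ c : ℝ, 0 ≤ c ∧ ∀ n (k : Fin d → Fin (2 ^ n)),
      |increment (fun t => X t ω) (dyadicCube n k)| ≤
        c * (dyadicCube n k).vol ^ (δ / q - 1 / ((m : ℝ) + 1)) := fun m =>
    ae_increment_le hX_meas hd hq hC (sub_lt_self _ (by positivity)) hmoment
  filter_upwards [ae_all_iff.2 h] with ω hω γ hγ hγ'
  obtain ⟨m, hm⟩ := exists_nat_one_div_lt (sub_pos.2 hγ')
  obtain ⟨c, hc, hω⟩ := hω m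
  refine isHolderStronglyChargeable_of_increment_le hd (hX_cont ω) hγ hc fun n k =>
    (hω n k).trans (mul_le_mul_of_nonneg_left ?_ hc)
  have h0 : 0 < (dyadicCube n k).vol := by
    rw [volume_real_dyadicCube]
    positivity
  have h1 : (dyadicCube n k).vol ≤ 1 := by
    rw [volume_real_dyadicCube]
    exact pow_le_one₀ (by positivity) (inv_le_one_of_one_le₀ (one_le_pow₀ one_le_two))
  exact Real.rpow_le_rpow_of_exponent_ge h0 h1 (by linarith)
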